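/- Let $\Gamma$ be a metrized graph: a finite connected graph (loops and multiple edges allowed) with non-empty vertex set $V$ and edge set $E$, in which each edge $e$ is parametrized by a segment of length $L_e>0$. Write $\ell(\Gamma)=\sum_{e}L_e$, let $v(p)$ be the valence of a vertex $p$ (loops count twice) and $g(\Gamma)=\#E-\#V+1$. For points $x,y,z$ of $\Gamma$ let $j_z(x,y)$ be the voltage function, i.e. $j_z(\cdot,y)$ is the continuous function on $\Gamma$ with $\Delta j_z(\cdot,y)=\delta_y-\delta_z$ and $j_z(z,y)=0$, where $\Delta f=-f''dx-\sum_p\big(\text{sum of the outgoing slopes of } f \text{ at } p\big)\delta_p$; let $r(x,y)=j_y(x,x)$ be the effective resistance. The tau constant $\tau(\Gamma)$ is the constant value of $\frac12\int_\Gamma j_\zeta(x,x)\,d\mu(\zeta)$, where $\mu$ is the unique real signed Borel measure of total mass $1$ for which this is independent of $x\in\Gamma$. Let $\mathbf q:V\to\mathbb Z_{\ge 0}$ be such that the divisor $K=\sum_{p\in V}k_p\,p$, $k_p=v(p)-2+2\mathbf q(p)$, is effective; then $(\Gamma,\mathbf q)$ is called a pm-graph, of genus $\bar g=g(\Gamma)+\sum_{p}\mathbf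 q(p)\ (\ge 1)$. Put $\delta_K=\sum_p k_p\delta_p$ and $$\mu_{ad}=\frac1{\bar g}\Big(\sum_{p\in V}\mathbf q(p)\delta_p+\sum_{e\in E}\frac{dx}{L_e+R_e}\Big),$$ where $R_e$ is the effective resistance between the end points of $e$ in the graph $\Gamma-e$ obtained by deleting the interior of $e$ ($R_e=\infty$ if $\Gamma-e$ is disconnected), and $$\epsilon(\Gamma)=\iint r(x,y)\,d\delta_K(x)\,d\mu_{ad}(y),\quad a(\Gamma)=\frac12\iint r(x,y)\,d\mu_{ad}(x)\,d\mu_{ad}(y),\quad \theta(\Gamma)=\sum_{p,p'\in V}k_pk_{p'}\,r(p,p').$$ **Theorem.** Let $(\Gamma,\mathbf q)$ be a bridgeless pm-graph, i.e. $\Gamma-e$ is connected for every edge $e$. Then $$\frac{\bar g-1}{\bar g+1}\big(\ell(\Gamma)-4\bar g\,a(\Gamma)\big)\le\epsilon(\Gamma).\qquad(1)$$ If moreover $\bar g\ge 2$, then (1) is equivalent to $$\ell(\Gamma)\le 12\,\tau(\Gamma)+\frac{\theta(\Gamma)}{\bar g-1},\qquad(2)$$ so that (2) holds as well. In particular (1)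 holds for every irreducible pm-graph, i.e. one whose underlying metrized graph cannot be disconnected by deleting any single point; this is the first inequality of Zhang's Conjecture 4.1.2. -/

import Mathlib

open MeasureTheory Topology Set
open scoped BigOperators

noncomputable section

/-- A finite multigraph (loops and multiple edges allowed) with vertex set `V` and edge set `E`, in
which the edge `e` is parametrized by a segment `[0, len e]` of positive length, running from
`src e` to `tgt e`. Connectedness is a separate predicate. -/
structure LengthGraph (V E : Type*) where
  src : E → V
  tgt : E → V
  len : E → ℝ
  len_pos : ∀ e, 0 < len e

/-- The points of the geometric realization: the vertices, and for each edge `e` the interior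
points with parameter `t`, `0 < t < len e`. -/
inductive LengthGraph.Point {V E : Type*} (Γ : LengthGraph V E) : Type _
  | vertex (p : V) : LengthGraph.Point Γ
  | inner (e : E) (t : ℝ) (h0 : 0 < t) (h1 : t < Γ.len e) : LengthGraph.Point Γ

namespace LengthGraph

variable {V E : Type*}

/-- There is an edge joining `p` and `q`. -/
def Adj (Γ : LengthGraph V E) (p q : V) : Prop :=
  ∃ e, (Γ.src e = p ∧ Γ.tgt e = q) ∨ (Γ.src e = q ∧ Γ.tgt e = p)

/-- The graph is non-empty and any two vertices are joined by a path. -/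
def Connected (Γ : LengthGraph V E) : Prop :=
  Nonempty V ∧ ∀ p q, Relation.ReflTransGen Γ.Adj p q

/-- `Γ - e`: the (interior of the) edge `e` is deleted. -/
def delete (Γ : LengthGraph V E) (e : E) : LengthGraph V {e' : E // e' ≠ e} where
  src e' := Γ.src e'
  tgt e' := Γ.tgt e'
  len e' := Γ.len e'
  len_pos e' := Γ.len_pos e'

/-- No edge disconnects the graph when it is deleted. -/
def Bridgeless (Γ : LengthGraph V E) : Prop := ∀ e, (Γ.delete e).Connected

open Classical in
/-- The parametrization of the edge `e` by `[0, len e]`, extended to all of `ℝ` by clamping. -/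
def edgePoint (Γ : LengthGraph V E) (e : E) (t : ℝ) : Γ.Point :=
  if h0 : 0 < t then
    if h1 : t < Γ.len e then Point.inner e t h0 h1 else Point.vertex (Γ.tgt e)
  else Point.vertex (Γ.src e)

/-- The quotient topology of the realization: a set is open iff its preimage in every edge is. -/
instance (Γ : LengthGraph V E) : TopologicalSpace Γ.Point :=
  ⨆ e, TopologicalSpace.coinduced (Γ.edgePoint e) inferInstance

instance (Γ : LengthGraph V E) : MeasurableSpace Γ.Point := borel Γ.Point

instance (Γ : LengthGraph V E) : BorelSpace Γ.Point := ⟨rfl⟩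

/-- The realization cannot be disconnected by deleting a single point. -/
def Irreducible (Γ : LengthGraph V E) : Prop :=
  ∀ x : Γ.Point, IsPreconnected ({x}ᶜ : Set Γ.Point)

variable [Fintype E]

open Classical in
/-- The number of directions emanating from a vertex; a loop counts twice. -/
def valence (Γ : LengthGraph V E) (p : V) : ℕ :=
  (Finset.univ.filter fun e => Γ.src e = p).card + (Finset.univ.filter fun e => Γ.tgt e = p).card

/-- The total length. -/
def totalLength (Γ : LengthGraph V E) : ℝ := ∑ e, Γ.len e

/-- The first Betti number of a connected graph. -/
def genus [Fintype V] (_Γ : LengthGraph V E) : ℤ := Fintype.card E - Fintype.card V + 1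

open Classical in
/-- The sum of the derivatives of `f` at the given point in all the directions emanating from it,
with respect to arc length. -/
def outSlope (Γ : LengthGraph V E) (f : Γ.Point → ℝ) : Γ.Point → ℝ
  | .vertex p =>
      (∑ e with Γ.src e = p, derivWithin (fun s => f (Γ.edgePoint e s)) (Ici 0) 0)
        - ∑ e with Γ.tgt e = p, derivWithin (fun s => f (Γ.edgePoint e s)) (Iic (Γ.len e)) (Γ.len e)
  | .inner e t _ _ =>
      derivWithin (fun s => f (Γ.edgePoint e s)) (Ici t) t
        - derivWithin (fun s => f (Γ.edgePoint e s)) (Iic t) t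

open Classical in
/-- `f` is the electric potential on `Γ`, with value `0` at `z`, when unit current enters at `y` and
exits at `z`. That is, `f` is continuous, `f z = 0`, and `Δ f = δ_y - δ_z` for the measure valued
Laplacian `Δ f = - f'' dx - ∑ x, (sum of the outgoing slopes of f at x) δ_x`: away from the
vertices and from `y` and `z` the function is locally affine (`f'' = 0`), and the
point masses are as stated (in an interior point other than `y`, `z` they vanish by affineness). -/
structure IsPotential (Γ : LengthGraph V E) (z y : Γ.Point) (f : Γ.Point → ℝ) : Prop where
  continuous : Continuous f
  base : f z = 0
  affine : ∀ (e : E) (t : ℝ), 0 < t → t < Γ.len e → Γ.edgePoint e t ≠ y → Γ.edgePoint e t ≠ z →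
    ∃ m : ℝ, ∀ᶠ s in 𝓝 t, f (Γ.edgePoint e s) = f (Γ.edgePoint e t) + m * (s - t)
  laplacian : ∀ x : Γ.Point,
    -Γ.outSlope f x = (if x = y then 1 else 0) - (if x = z then 1 else 0)

open Classical in
/-- The voltage function `j_z(x, y)`: the potential difference between `x` and `z` when unit current
enters at `y` and exits at `z`. (On a connected graph the potential exists and is unique.) -/
def voltage (Γ : LengthGraph V E) (z x y : Γ.Point) : ℝ :=
  if h : ∃ f, Γ.IsPotential z y f then h.choose x else 0

/-- The effective resistance `r(x, y) = j_y(x, x)`. -/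
def resistance (Γ : LengthGraph V E) (x y : Γ.Point) : ℝ := Γ.voltage y x x

/-- `j_μ(x, y) = ∫ j_ζ(x, y) dμ(ζ)` for a signed Borel measure `μ`. -/
def voltageIntegral (Γ : LengthGraph V E) (μ : SignedMeasure Γ.Point) (x y : Γ.Point) : ℝ :=
  ∫ᵛ ζ, Γ.voltage ζ x y ∂<•μ

/-- `t` is half of the constant value of `j_μ(x, x)`, for some signed Borel measure `μ` of
total mass `1` for which `j_μ(x, x)` is constant (that is, for the canonical measure). -/
def IsTauConstant (Γ : LengthGraph V E) (t : ℝ) : Prop :=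
  ∃ μ : SignedMeasure Γ.Point, μ univ = 1 ∧ ∀ x, (1 / 2) * Γ.voltageIntegral μ x x = t

open Classical in
/-- The tau constant `τ(Γ)`. -/
def tau (Γ : LengthGraph V E) : ℝ :=
  if h : ∃ t, Γ.IsTauConstant t then h.choose else 0

open Classical in
/-- `1 / (L + R)`, where `L` is the length of the edge `e` and `R` is the resistance between
its end points in `Γ - e`; this is `0` if `e` is a bridge (`R = ∞`). -/
def edgeDensity (Γ : LengthGraph V E) (e : E) : ℝ :=
  if (Γ.delete e).Connected then
    1 / (Γ.len e + (Γ.delete e).resistance (.vertex (Γ.src e)) (.vertex (Γ.tgt e)))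
  else 0

/-- The arc length measure `dx` of the edge `e`, as a measure on the realization. -/
def edgeMeasure (Γ : LengthGraph V E) (e : E) : Measure Γ.Point :=
  (volume.restrict (Icc 0 (Γ.len e))).map (Γ.edgePoint e)

end LengthGraph

/-- A polarized metrized graph: a connected metrized graph with a function `q : V → ℕ` on its
vertices for which the canonical divisor `K = ∑ p, (v(p) - 2 + 2 q(p)) p` is effective. -/
structure PMGraph (V E : Type*) [Fintype V] [Fintype E] extends LengthGraph V E where
  connected : toLengthGraph.Connected
  q : V → ℕ
  effective : ∀ p, 0 ≤ (toLengthGraph.valence p : ℤ) - 2 + 2 * (q p : ℤ)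

namespace PMGraph

variable {V E : Type*} [Fintype V] [Fintype E]

/-- The multiplicity of the vertex `p` in the canonical divisor `K`. -/
def canon (Γ : PMGraph V E) (p : V) : ℤ := (Γ.valence p : ℤ) - 2 + 2 * (Γ.q p : ℤ)

/-- The genus of the pm-graph: the first Betti number plus `∑ p, q(p)`. -/
def pmGenus (Γ : PMGraph V E) : ℤ := Γ.genus + ∑ p, (Γ.q p : ℤ)

/-- `δ_K = ∑ p, (v(p) - 2 + 2 q(p)) δ_p`; the coefficients are non-negative. -/
def canonMeasure (Γ : PMGraph V E) : Measure Γ.Point :=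
  ∑ p, (Γ.canon p).toNat • Measure.dirac (.vertex p)

/-- The admissible measure `(1 / ḡ) (∑ p, q(p) δ_p + ∑ e, dx / (L_e + R_e))`. -/
def admissibleMeasure (Γ : PMGraph V E) : Measure Γ.Point :=
  ENNReal.ofReal (1 / (Γ.pmGenus : ℝ)) •
    ((∑ p, Γ.q p • Measure.dirac (.vertex p)) +
      ∑ e, ENNReal.ofReal (Γ.edgeDensity e) • Γ.edgeMeasure e)

/-- `ε(Γ) = ∬ r(x, y) dδ_K(x) dμ_ad(y)`. -/
def epsilon (Γ : PMGraph V E) : ℝ :=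
  ∫ y, ∫ x, Γ.resistance x y ∂Γ.canonMeasure ∂Γ.admissibleMeasure

/-- `a(Γ) = (1 / 2) ∬ r(x, y) dμ_ad(x) dμ_ad(y)`. -/
def aInv (Γ : PMGraph V E) : ℝ :=
  (1 / 2) * ∫ y, ∫ x, Γ.resistance x y ∂Γ.admissibleMeasure ∂Γ.admissibleMeasure

/-- `θ(Γ) = ∑ p q, (v(p) - 2 + 2 q(p)) (v(q) - 2 + 2 q(q)) r(p, q)`. -/
def theta (Γ : PMGraph V E) : ℝ :=
  ∑ p, ∑ p', (Γ.canon p : ℝ) * (Γ.canon p' : ℝ) * Γ.resistance (.vertex p) (.vertex p')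

end PMGraph

end

noncomputable section

/-! ### The discrete Laplacian on the vertices. -/

namespace LengthGraph

open scoped Classical

variable {V E : Type*} (Γ : LengthGraph V E)

/-! Let μ_can = ∑ (1 - v(p)/2) δ_p + ∑ dx/(L_e + R_e) and T = ∫ r(x, ·) dμ_can, which does not
depend on x (`canonInt_resistance_eq`). If j_μ(x, x) is constant for a signed measure μ of mass 1,
integrating it against μ_can and using Fubini shows that the constant is T, so T = 2τ (`tau_eq`).
Moreover ḡ μ_ad = δ_K/2 + μ_can (`integral_admissibleMeasure`), whence ḡ ε = θ/2 + 2(ḡ - 1)T and 4ḡ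
a = ε + 2T. Thus (1) amounts to (ḡ - 1) ℓ ≤ 6(ḡ - 1) T + θ (`le_epsilon_iff`), which is (2)
multiplied by ḡ - 1.

This bound is a weighted sum of pointwise ones: ℓ ≤ 6T + 2 ∑_q (v(q) - 2) r(p, q) for every vertex p
(`totalLength_le`). Replace v(q) - 2 by the larger k_q, multiply by k_p ≥ 0 and sum, with deg K =
2(ḡ - 1). Evaluating T at p by an energy identity turns the pointwise bound into a sum over the
edges e, with end points a, b, of 4 (j_p(a,b) - (j_p(a,a) j_p(b,b) - j_p(a,b)²)/L_e). Each summand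
is non-negative (`len_minor_le`): apply the minimum principle to j_p(b,b) j_p(a, ·) - j_p(a,b)
j_p(b, ·), then look at its Laplacian at b.

Everything is computed from a Green function `G` of the weighted graph on the vertices. Its
extension `green` to the realization expresses all voltages (`voltage_eq`), and 1/(L_e + R_e) = (L_e
- r_e)/L_e², where r_e is the resistance in Γ between the ends of e. -/

theorem eq_of_forall_edge (hΓ : Γ.Connected) {α : Type*} (f : V → α)
    (h : ∀ e, f (Γ.src e) = f (Γ.tgt e)) (p q : V) : f p = f q := by
  induction hΓ.2 p q with
  | refl => rfl
  | tail _ h2 ih =>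
    obtain ⟨e, ⟨rfl, rfl⟩ | ⟨rfl, rfl⟩⟩ := h2
    · rw [ih, h]
    · rw [ih, h]

variable [Fintype E]

/-- The discrete Laplacian on functions on the vertices, the edge `e` having conductance
`1 / len e`. -/
def lap (f : V → ℝ) (q : V) : ℝ :=
  ∑ e, (f (Γ.src e) - f (Γ.tgt e)) / Γ.len e *
    ((if Γ.src e = q then 1 else 0) - (if Γ.tgt e = q then 1 else 0))

/-- The Dirichlet form of the discrete Laplacian. -/
def energy (f g : V → ℝ) : ℝ :=
  ∑ e, (f (Γ.src e) - f (Γ.tgt e)) * (g (Γ.src e) - g (Γ.tgt e)) / Γ.len e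

theorem lap_add (f g : V → ℝ) (q : V) :
    Γ.lap (fun p => f p + g p) q = Γ.lap f q + Γ.lap g q := by
  simp only [lap, ← Finset.sum_add_distrib]
  exact Finset.sum_congr rfl fun e _ => by ring

theorem lap_const_mul (c : ℝ) (f : V → ℝ) (q : V) :
    Γ.lap (fun p => c * f p) q = c * Γ.lap f q := by
  simp only [lap, Finset.mul_sum]
  exact Finset.sum_congr rfl fun e _ => by ring

theorem lap_sub (f g : V → ℝ) (q : V) :
    Γ.lap (fun p => f p - g p) q = Γ.lap f q - Γ.lap g q := by
  simp only [lap, ← Finset.sum_sub_distrib]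
  exact Finset.sum_congr rfl fun e _ => by ring

theorem lap_const (c : ℝ) (q : V) : Γ.lap (fun _ => c) q = 0 := by
  simp [lap]

theorem energy_comm (f g : V → ℝ) : Γ.energy f g = Γ.energy g f :=
  Finset.sum_congr rfl fun e _ => by ring

theorem eq_of_energy_eq_zero (hΓ : Γ.Connected) (f : V → ℝ) (h : Γ.energy f f = 0) (p q : V) :
    f p = f q := by
  refine Γ.eq_of_forall_edge hΓ f (fun e => ?_) p q
  have h0 : ∀ e ∈ Finset.univ, 0 ≤
      (f (Γ.src e) - f (Γ.tgt e)) * (f (Γ.src e) - f (Γ.tgt e)) / Γ.len e := fun e _ =>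
    div_nonneg (mul_self_nonneg _) (Γ.len_pos e).le
  have h1 := (Finset.sum_eq_zero_iff_of_nonneg h0).1 h e (Finset.mem_univ e)
  have := (Γ.len_pos e).ne'
  simp only [div_eq_zero_iff, mul_self_eq_zero, this, or_false] at h1
  linarith

variable [Fintype V]

theorem sum_mul_lap (f g : V → ℝ) : ∑ q, g q * Γ.lap f q = Γ.energy f g := by
  simp only [lap, energy, Finset.mul_sum]
  rw [Finset.sum_comm]
  refine Finset.sum_congr rfl fun e _ => ?_
  simp only [mul_sub, Finset.sum_sub_distrib, mul_ite, mul_one, mul_zero, Finset.sum_ite_eq,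
    Finset.mem_univ, if_true]
  ring

theorem sum_lap (f : V → ℝ) : ∑ q, Γ.lap f q = 0 := by
  simpa [energy] using Γ.sum_mul_lap f (fun _ => 1)

theorem sum_mul_lap_comm (f g : V → ℝ) : ∑ q, g q * Γ.lap f q = ∑ q, f q * Γ.lap g q := by
  rw [sum_mul_lap, sum_mul_lap, energy_comm]

theorem eq_of_lap_eq_zero (hΓ : Γ.Connected) (f : V → ℝ) (h : ∀ q, Γ.lap f q = 0) (p q : V) :
    f p = f q := by
  refine Γ.eq_of_energy_eq_zero hΓ f ?_ p q
  rw [← sum_mul_lap]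
  simp [h]

/-- The minimum principle: a function which is superharmonic wherever it is negative, and
non-negative somewhere, is non-negative. -/
theorem nonneg_of_lap_nonneg (hΓ : Γ.Connected) (f : V → ℝ) {p : V} (hp : 0 ≤ f p)
    (h : ∀ q, f q < 0 → 0 ≤ Γ.lap f q) (q : V) : 0 ≤ f q := by
  have hne : (Finset.univ : Finset V).Nonempty := ⟨p, Finset.mem_univ p⟩
  obtain ⟨m, -, hm⟩ := Finset.exists_min_image Finset.univ f hne
  by_contra! hq
  have hmin : f m < 0 := (hm q (Finset.mem_univ q)).trans_lt hq
  -- Where the negative minimum is attained, all terms of the Laplacian are ≤ 0 while their sum is ≥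
  -- 0. So they vanish, and the minimal value passes to the neighbours, eventually reaching `p`.
  have key : ∀ x, f x = f m → ∀ y, Γ.Adj x y → f y = f m := by
    intro x hx y hxy
    have hle : ∀ z, f x ≤ f z := fun z => hx ▸ hm z (Finset.mem_univ z)
    have hterm : ∀ e ∈ Finset.univ, (f (Γ.src e) - f (Γ.tgt e)) / Γ.len e *
        ((if Γ.src e = x then 1 else 0) - (if Γ.tgt e = x then 1 else 0)) ≤ 0 := by
      intro e _
      have hl := (Γ.len_pos e).le
      split_ifs with h1 h2 h2
      · simp
      · have := hle (Γ.tgt e)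
        rw [h1, sub_zero, mul_one]
        exact div_nonpos_of_nonpos_of_nonneg (by linarith) hl
      · have := hle (Γ.src e)
        rw [h2, zero_sub, mul_neg, mul_one, neg_nonpos]
        exact div_nonneg (by linarith) hl
      · simp
    have hz := (Finset.sum_eq_zero_iff_of_nonpos hterm).1
      (le_antisymm (Finset.sum_nonpos hterm) (h x (hx ▸ hmin)))
    by_cases hxy' : x = y
    · rw [← hxy', hx]
    obtain ⟨e, he⟩ := hxy
    have h1 := hz e (Finset.mem_univ e)
    have hl := (Γ.len_pos e).ne'
    obtain ⟨h2, h3⟩ | ⟨h2, h3⟩ := he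
    · simp [h2, h3, Ne.symm hxy', hl] at h1
      linarith
    · simp [h2, h3, Ne.symm hxy', hl] at h1
      linarith
  have hall : ∀ x, Relation.ReflTransGen Γ.Adj m x → f x = f m := by
    intro x hx
    induction hx with
    | refl => rfl
    | tail _ h2 ih => exact key _ ih _ h2
  have := hall p (hΓ.2 m p)
  linarith

/-! ### Green functions on the vertices, effective resistance and Foster's theorem. -/

/-- A symmetric generalized inverse of the discrete Laplacian. -/
structure IsGreen (G : V → V → ℝ) : Prop where
  symm : ∀ p q, G p q = G q p
  lap_eq : ∀ p q, Γ.lap (G p) q = (if p = q then 1 else 0) - 1 / (Fintype.card V : ℝ)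

theorem exists_isGreen (hΓ : Γ.Connected) : ∃ G, Γ.IsGreen G := by
  obtain ⟨p₀⟩ := hΓ.1
  have hn : (Fintype.card V : ℝ) ≠ 0 := by
    have : 0 < Fintype.card V := Fintype.card_pos_iff.2 ⟨p₀⟩
    positivity
  -- The kernel of the Laplacian consists of the constants; adding the total sum removes it. The
  -- rows of the inverse of `T` form the Green function.
  let T : (V → ℝ) →ₗ[ℝ] (V → ℝ) :=
    { toFun := fun f q => Γ.lap f q + ∑ p, f p
      map_add' := fun f g => by
        funext q
        have := Γ.lap_add f g q
        simp only [Pi.add_apply, Finset.sum_add_distrib]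
        rw [show f + g = fun p => f p + g p from rfl, this]
        ring
      map_smul' := fun c f => by
        funext q
        have := Γ.lap_const_mul c f q
        simp only [Pi.smul_apply, smul_eq_mul, RingHom.id_apply]
        rw [show c • f = fun p => c * f p from rfl, this, mul_add, Finset.mul_sum] }
  have hTs : ∀ f, ∑ q, T f q = Fintype.card V * ∑ p, f p := by
    intro f
    simp [T, Finset.sum_add_distrib, sum_lap]
  have hinj : Function.Injective T := by
    rw [injective_iff_map_eq_zero]
    intro f hf
    have hs : ∑ p, f p = 0 := by
      have := hTs f
      rw [hf] at this
      simpa [hn] using this.symm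
    have hl : ∀ q, Γ.lap f q = 0 := by
      intro q
      have : T f q = 0 := by rw [hf]; rfl
      simpa [T, hs] using this
    have hc := Γ.eq_of_lap_eq_zero hΓ f hl p₀
    have : ∑ p, f p = Fintype.card V * f p₀ := by simp [← hc]
    funext q
    rw [hs, eq_comm, mul_eq_zero, or_iff_right hn] at this
    simp [← hc q, this]
  have hsurj := LinearMap.surjective_of_injective hinj
  choose G hG using fun p => hsurj (Pi.single p 1)
  have hGs : ∀ p, ∑ q, G p q = 1 / (Fintype.card V : ℝ) := by
    intro p
    have := hTs (G p)
    rw [hG] at this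
    simp only [Finset.sum_pi_single', Finset.mem_univ, if_true] at this
    field_simp
    linarith
  have hl : ∀ p q, Γ.lap (G p) q = (if p = q then 1 else 0) - 1 / (Fintype.card V : ℝ) := by
    intro p q
    have : T (G p) q = (Pi.single p 1 : V → ℝ) q := by rw [hG]
    rw [Pi.single_apply] at this
    simp only [eq_comm (a := q)] at this
    rw [← this, ← hGs p]
    simp [T]
  refine ⟨G, fun p q => ?_, hl⟩
  -- Self-adjointness gives symmetry because all rows have the same sum, so the two 1/#V corrections
  -- cancel.
  have := Γ.sum_mul_lap_comm (G p) (G q)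
  simp only [hl, mul_sub, Finset.sum_sub_distrib, ← Finset.sum_mul, hGs, mul_ite, mul_one,
    mul_zero, Finset.sum_ite_eq, Finset.mem_univ, if_true] at this
  linarith

/-- The effective resistance between two vertices, in terms of a Green function. -/
def res (G : V → V → ℝ) (p q : V) : ℝ := G p p + G q q - 2 * G p q

namespace IsGreen

variable {Γ} {G : V → V → ℝ}

theorem sum_mul_lap (hG : Γ.IsGreen G) (f : V → ℝ) (p : V) :
    ∑ q, G p q * Γ.lap f q = f p - (∑ q, f q) / Fintype.card V := by
  rw [Γ.sum_mul_lap_comm]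
  simp only [hG.lap_eq, mul_sub, Finset.sum_sub_distrib, ← Finset.sum_mul, mul_ite, mul_one,
    mul_zero, Finset.sum_ite_eq, Finset.mem_univ, if_true]
  ring

/-- A potential difference is the current times the resistance. -/
theorem sub_eq_mul_res (hG : Γ.IsGreen G) (f : V → ℝ) (s : ℝ) (a b : V)
    (h : ∀ q, Γ.lap f q = s * ((if a = q then 1 else 0) - (if b = q then 1 else 0))) :
    f a - f b = s * res G a b := by
  have h1 := hG.sum_mul_lap f a
  have h2 := hG.sum_mul_lap f b
  have h3 : ∀ p, ∑ q, G p q * Γ.lap f q = s * (G p a - G p b) := by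
    intro p
    simp only [h, mul_sub, Finset.sum_sub_distrib, mul_ite, mul_one,
      mul_zero, Finset.sum_ite_eq, Finset.mem_univ, if_true]
    ring
  rw [h3] at h1 h2
  have h4 := hG.symm b a
  rw [h4] at h2
  simp only [res]
  linarith

theorem res_eq_energy (hG : Γ.IsGreen G) (a b : V) :
    res G a b = Γ.energy (fun p => G a p - G b p) (fun p => G a p - G b p) := by
  rw [← Γ.sum_mul_lap]
  simp only [Γ.lap_sub, hG.lap_eq]
  have : ∀ q, (G a q - G b q) * ((if a = q then 1 else 0) - 1 / (Fintype.card V : ℝ) -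
      ((if b = q then 1 else 0) - 1 / (Fintype.card V : ℝ))) =
      (if a = q then (G a q - G b q) else 0) - (if b = q then (G a q - G b q) else 0) := by
    intro q
    split_ifs <;> ring
  simp only [this, Finset.sum_sub_distrib, Finset.sum_ite_eq, Finset.mem_univ, if_true, res,
    hG.symm b a]
  ring

theorem res_nonneg (hG : Γ.IsGreen G) (a b : V) : 0 ≤ res G a b := by
  rw [hG.res_eq_energy]
  exact Finset.sum_nonneg fun e _ => div_nonneg (mul_self_nonneg _) (Γ.len_pos e).le

/-- The Laplacian of the diagonal of the Green function. -/
theorem lap_diag (hG : Γ.IsGreen G) (q : V) :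
    Γ.lap (fun p => G p p) q = 2 - 2 / (Fintype.card V : ℝ) -
      ∑ e, res G (Γ.src e) (Γ.tgt e) / Γ.len e *
        ((if Γ.src e = q then 1 else 0) + (if Γ.tgt e = q then 1 else 0)) := by
  have h := hG.lap_eq q q
  rw [if_pos rfl] at h
  have h2 : (2 : ℝ) - 2 / (Fintype.card V : ℝ) = 2 * Γ.lap (G q) q := by rw [h]; ring
  rw [h2, lap, lap, Finset.mul_sum, ← Finset.sum_sub_distrib]
  refine Finset.sum_congr rfl fun e _ => ?_
  have hl := (Γ.len_pos e).ne'
  by_cases h1 : Γ.src e = q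
  · subst h1
    by_cases h3 : Γ.tgt e = Γ.src e
    · simp only [res, h3]
      simp only [if_true]
      ring
    · simp only [h3, if_true, if_false, res]
      field_simp
      ring
  · by_cases h3 : Γ.tgt e = q
    · subst h3
      simp only [h1, if_true, if_false, res, hG.symm (Γ.tgt e) (Γ.src e)]
      field_simp
      ring
    · simp [h1, h3]

/-- **Foster's theorem.** -/
theorem sum_res_div_len (hG : Γ.IsGreen G) (hV : Nonempty V) :
    ∑ e, res G (Γ.src e) (Γ.tgt e) / Γ.len e = Fintype.card V - 1 := by
  have h := Γ.sum_lap (fun p => G p p)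
  simp only [hG.lap_diag] at h
  rw [Finset.sum_sub_distrib, Finset.sum_comm] at h
  simp only [← Finset.mul_sum, Finset.sum_add_distrib, Finset.sum_ite_eq, Finset.mem_univ,
    if_true, Finset.sum_const, Finset.card_univ, nsmul_eq_mul] at h
  rw [← Finset.sum_mul] at h
  have : (Fintype.card V : ℝ) ≠ 0 := by
    have : 0 < Fintype.card V := Fintype.card_pos
    positivity
  field_simp at h
  linarith

theorem lap_res (hG : Γ.IsGreen G) (p q : V) :
    Γ.lap (res G p) q = 2 - 2 * (if p = q then 1 else 0) -
      ∑ e, res G (Γ.src e) (Γ.tgt e) / Γ.len e *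
        ((if Γ.src e = q then 1 else 0) + (if Γ.tgt e = q then 1 else 0)) := by
  have : Γ.lap (res G p) q = Γ.lap (fun x => (G p p + G x x) - 2 * G p x) q := rfl
  rw [this, Γ.lap_sub, Γ.lap_add, Γ.lap_const, Γ.lap_const_mul, hG.lap_diag, hG.lap_eq]
  ring

/-- The left side is the Dirichlet energy of r(p, ·), obtained by pairing this function with its own
Laplacian. The point mass at `p` contributes nothing since r(p, p) = 0. -/
theorem sum_sq_res (hG : Γ.IsGreen G) (p : V) :
    ∑ e, (res G p (Γ.src e) - res G p (Γ.tgt e)) ^ 2 / Γ.len e =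
      2 * ∑ q, res G p q - ∑ e, res G (Γ.src e) (Γ.tgt e) / Γ.len e *
        (res G p (Γ.src e) + res G p (Γ.tgt e)) := by
  have h := Γ.sum_mul_lap (res G p) (res G p)
  have h0 : res G p p = 0 := by simp only [res]; ring
  have h1 : ∀ q, res G p q * (if p = q then 1 else 0) = 0 := by
    intro q; split_ifs with hq
    · rw [← hq, h0, zero_mul]
    · simp
  have h2 : Γ.energy (res G p) (res G p) =
      ∑ e, (res G p (Γ.src e) - res G p (Γ.tgt e)) ^ 2 / Γ.len e :=
    Finset.sum_congr rfl fun e _ => by ring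
  rw [← h2, ← h]
  simp only [hG.lap_res, mul_sub, Finset.sum_sub_distrib, mul_left_comm _ (2 : ℝ), h1]
  simp only [mul_zero, Finset.sum_const_zero, sub_zero, Finset.mul_sum]
  congr 1
  · exact Finset.sum_congr rfl fun q _ => mul_comm _ _
  rw [Finset.sum_comm]
  refine Finset.sum_congr rfl fun e _ => ?_
  have : ∀ q, res G p q * (res G (Γ.src e) (Γ.tgt e) / Γ.len e *
        ((if Γ.src e = q then 1 else 0) + (if Γ.tgt e = q then 1 else 0))) =
      (if Γ.src e = q then res G (Γ.src e) (Γ.tgt e) / Γ.len e * res G p q else 0) +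
      (if Γ.tgt e = q then res G (Γ.src e) (Γ.tgt e) / Γ.len e * res G p q else 0) := by
    intro q; split_ifs <;> ring
  simp only [this, Finset.sum_add_distrib, Finset.sum_ite_eq, Finset.mem_univ, if_true]
  ring

/-- By symmetry the row sum, as a function of the row, is the sum of all functions `G x`; its
Laplacian vanishes, so it is constant. `IsGreen` itself does not fix the value of the row sums. -/
theorem sum_eq (hG : Γ.IsGreen G) (hV : Nonempty V) (p q : V) : ∑ x, G p x = ∑ x, G q x := by
  have h1 := hG.sum_mul_lap (fun y => ∑ x, G y x) p
  have h2 : ∀ y, Γ.lap (fun y => ∑ x, G y x) y = 0 := by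
    intro y
    have : Γ.lap (fun y => ∑ x, G y x) y = ∑ x, Γ.lap (G x) y := by
      simp only [lap]
      rw [Finset.sum_comm]
      refine Finset.sum_congr rfl fun e _ => ?_
      rw [← Finset.sum_mul, ← Finset.sum_div, Finset.sum_sub_distrib]
      simp only [hG.symm _ (Γ.src e), hG.symm _ (Γ.tgt e)]
    rw [this]
    have : (Fintype.card V : ℝ) ≠ 0 := by
      have : 0 < Fintype.card V := Fintype.card_pos
      positivity
    simp [hG.lap_eq, this]
  have h3 := hG.sum_mul_lap (fun y => ∑ x, G y x) q
  simp only [h2, mul_zero, Finset.sum_const_zero] at h1 h3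
  linarith

/-- The diagonal of the Green function corrected by edge resistances is constant. -/
theorem diag_add_sum (hG : Γ.IsGreen G) (hV : Nonempty V) (p q : V) :
    G p p + ∑ e, res G (Γ.src e) (Γ.tgt e) / Γ.len e * (G p (Γ.src e) + G p (Γ.tgt e)) =
    G q q + ∑ e, res G (Γ.src e) (Γ.tgt e) / Γ.len e * (G q (Γ.src e) + G q (Γ.tgt e)) := by
  -- Pairing `G p` with the Laplacian of the diagonal leaves a right side depending on `p` only
  -- through the row sum of `G p`.
  have key : ∀ p, G p p + ∑ e, res G (Γ.src e) (Γ.tgt e) / Γ.len e *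
      (G p (Γ.src e) + G p (Γ.tgt e)) = (∑ q, G q q) / Fintype.card V +
        (2 - 2 / (Fintype.card V : ℝ)) * ∑ q, G p q := by
    intro p
    have h := hG.sum_mul_lap (fun p => G p p) p
    simp only [hG.lap_diag, mul_sub, Finset.sum_sub_distrib] at h
    have h2 : ∑ q, G p q * ∑ e, res G (Γ.src e) (Γ.tgt e) / Γ.len e *
        ((if Γ.src e = q then 1 else 0) + (if Γ.tgt e = q then 1 else 0)) =
        ∑ e, res G (Γ.src e) (Γ.tgt e) / Γ.len e * (G p (Γ.src e) + G p (Γ.tgt e)) := by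
      simp only [Finset.mul_sum]
      rw [Finset.sum_comm]
      refine Finset.sum_congr rfl fun e _ => ?_
      have : ∀ q, G p q * (res G (Γ.src e) (Γ.tgt e) / Γ.len e *
            ((if Γ.src e = q then 1 else 0) + (if Γ.tgt e = q then 1 else 0))) =
          (if Γ.src e = q then res G (Γ.src e) (Γ.tgt e) / Γ.len e * G p q else 0) +
          (if Γ.tgt e = q then res G (Γ.src e) (Γ.tgt e) / Γ.len e * G p q else 0) := by
        intro q; split_ifs <;> ring
      simp only [this, Finset.sum_add_distrib, Finset.sum_ite_eq, Finset.mem_univ, if_true]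
      ring
    rw [h2, ← Finset.sum_mul, ← Finset.sum_mul] at h
    linarith
  rw [key, key, hG.sum_eq hV p q]

/-! ### Grounded potentials and the inequality for a single edge. -/

/-- The potential `j_p(a, b)` normalized at the vertex `p`. -/
def _root_.LengthGraph.pot (G : V → V → ℝ) (p a b : V) : ℝ := G a b - G a p - G p b + G p p

/-- This carries the main inequality. The 2×2 minor of j_p on the ends a, b of `e` is U(a) for a
function U ≥ 0 with U(b) = 0. The current U(a)/L_e that flows along `e` into b is at most the whole
current arriving there, which is j_p(a,b). -/
theorem len_minor_le (hG : Γ.IsGreen G) (hΓ : Γ.Connected) (p : V) (e : E) :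
    (pot G p (Γ.src e) (Γ.src e) * pot G p (Γ.tgt e) (Γ.tgt e)
      - pot G p (Γ.src e) (Γ.tgt e) ^ 2) / Γ.len e ≤ pot G p (Γ.src e) (Γ.tgt e) := by
  set a := Γ.src e with ha
  set b := Γ.tgt e with hb
  have hsymm : ∀ x y, pot G p x y = pot G p y x := fun x y => by
    simp only [pot, hG.symm x y, hG.symm x p, hG.symm y p]; ring
  have hdiag : ∀ x, 0 ≤ pot G p x x := fun x => by
    have := hG.res_nonneg x p
    simp only [res, pot, hG.symm p x] at this ⊢
    linarith
  by_cases hab : a = b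
  · rw [← hab]
    have := hdiag a
    rw [show pot G p a a * pot G p a a - pot G p a a ^ 2 = 0 by ring, zero_div]
    exact this
  by_cases hpb : p = b
  · have h0 : ∀ x, pot G p x b = 0 := fun x => by simp only [pot, ← hpb]; ring
    simp [h0]
  -- The coefficients make U vanish at `b` as well as at `p`. Away from these two points its only
  -- source is at `a`, of strength j_p(b,b) ≥ 0, so the minimum principle applies.
  let U : V → ℝ := fun x => pot G p b b * pot G p a x - pot G p a b * pot G p b x
  have hlap : ∀ q, Γ.lap U q = pot G p b b * ((if a = q then 1 else 0) - (if p = q then 1 else 0))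
      - pot G p a b * ((if b = q then 1 else 0) - (if p = q then 1 else 0)) := by
    intro q
    have hp : ∀ y, Γ.lap (pot G p y) q =
        (if y = q then 1 else 0) - (if p = q then 1 else 0) := by
      intro y
      have : Γ.lap (pot G p y) q = Γ.lap (fun x => (G y x - G p x) + (G p p - G y p)) q := by
        congr 1; funext x; simp only [pot]; ring
      rw [this, Γ.lap_add, Γ.lap_sub, Γ.lap_const, hG.lap_eq, hG.lap_eq]
      ring
    have : Γ.lap U q = Γ.lap (fun x => pot G p b b * pot G p a x - pot G p a b * pot G p b x) q :=
      rfl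
    rw [this, Γ.lap_sub, Γ.lap_const_mul, Γ.lap_const_mul]
    rw [hp, hp]
  have hUp : U p = 0 := by simp only [U, pot]; ring
  have hUb : U b = 0 := by simp only [U]; ring
  have hU : ∀ x, 0 ≤ U x := by
    refine Γ.nonneg_of_lap_nonneg hΓ U hUp.ge fun q hq => ?_
    have h1 : p ≠ q := by rintro rfl; linarith
    have h2 : b ≠ q := by rintro rfl; linarith
    rw [hlap, if_neg h1, if_neg h2]
    have := hdiag b
    split_ifs <;> simp [this]
  have h1 := hlap b
  rw [if_neg hab, if_neg hpb, if_pos rfl] at h1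
  -- As U ≥ 0 = U(b), every edge contributes a non-positive term to the Laplacian at `b`; only that
  -- of `e` is kept.
  have h2 : Γ.lap U b ≤ -(U a / Γ.len e) := by
    have hterm : ∀ e' ∈ Finset.univ, (U (Γ.src e') - U (Γ.tgt e')) / Γ.len e' *
        ((if Γ.src e' = b then 1 else 0) - (if Γ.tgt e' = b then 1 else 0)) ≤
        if e' = e then -(U a / Γ.len e) else 0 := by
      intro e' _
      have hl := (Γ.len_pos e').le
      by_cases he : e' = e
      · subst he
        rw [if_pos rfl, ← ha, ← hb, if_neg hab, if_pos rfl, hUb]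
        apply le_of_eq; ring
      · rw [if_neg he]
        split_ifs with h3 h4 h4
        · simp
        · rw [h3, hUb, sub_zero, mul_one]
          exact div_nonpos_of_nonpos_of_nonneg (by linarith [hU (Γ.tgt e')]) hl
        · rw [h4, hUb, zero_sub, mul_neg, mul_one, neg_nonpos]
          exact div_nonneg (by linarith [hU (Γ.src e')]) hl
        · simp
    have := Finset.sum_le_sum hterm
    rwa [Finset.sum_ite_eq' , if_pos (Finset.mem_univ e)] at this
  have h3 : U a = pot G p a a * pot G p b b - pot G p a b ^ 2 := by
    simp only [U, hsymm b a]; ring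
  rw [← h3]
  linarith

end IsGreen

end LengthGraph

/-! ### Piecewise affine functions on the realization and uniqueness of potentials. -/

/-- The derivative is locally constant, hence constant on the open interval; the mean value theorem
extends the affine formula to the end points. -/
theorem exists_affine_Icc {f : ℝ → ℝ} {u v : ℝ} (hf : ContinuousOn f (Icc u v))
    (h : ∀ t ∈ Ioo u v, ∃ m : ℝ, ∀ᶠ s in 𝓝 t, f s = f t + m * (s - t)) :
    ∃ m : ℝ, ∀ s ∈ Icc u v, f s = f u + m * (s - u) := by
  have hd : ∀ t ∈ Ioo u v, ∃ m : ℝ, (∀ᶠ s in 𝓝 t, f s = f t + m * (s - t)) ∧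
      HasDerivAt f m t := by
    intro t ht
    obtain ⟨m, hm⟩ := h t ht
    refine ⟨m, hm, ?_⟩
    have h1 : HasDerivAt (fun s => f t + m * (s - t)) m t := by
      simpa using (((hasDerivAt_id t).sub_const t).const_mul m).const_add (f t)
    exact h1.congr_of_eventuallyEq hm
  have hd2 : ∀ t ∈ Ioo u v, HasDerivAt (deriv f) 0 t := by
    intro t ht
    obtain ⟨m, hm, -⟩ := hd t ht
    have : deriv f =ᶠ[𝓝 t] fun _ => m := by
      filter_upwards [hm.eventually_nhds] with s hs
      have h1 : HasDerivAt (fun s => f t + m * (s - t)) m s := by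
        simpa using (((hasDerivAt_id s).sub_const t).const_mul m).const_add (f t)
      exact (h1.congr_of_eventuallyEq hs).deriv
    exact (hasDerivAt_const t m).congr_of_eventuallyEq this
  have hconst : ∀ s ∈ Ioo u v, ∀ t ∈ Ioo u v, deriv f s = deriv f t := by
    intro s hs t ht
    refine isOpen_Ioo.is_const_of_deriv_eq_zero isPreconnected_Ioo
      (fun x hx => (hd2 x hx).differentiableAt.differentiableWithinAt)
      (fun x hx => (hd2 x hx).deriv) hs ht
  by_cases huv : u < v
  · obtain ⟨c, hc⟩ := exists_between huv
    refine ⟨deriv f c, fun s hs => ?_⟩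
    rcases hs.1.eq_or_lt with rfl | hus
    · simp
    have hsub : Ioo u s ⊆ Ioo u v := Ioo_subset_Ioo_right hs.2
    obtain ⟨x, hx, hx'⟩ := exists_deriv_eq_slope f hus (hf.mono (Icc_subset_Icc_right hs.2))
      (fun x hx => by
        obtain ⟨m, -, hm⟩ := hd x (hsub hx)
        exact hm.differentiableAt.differentiableWithinAt)
    rw [hconst c hc x (hsub hx), hx']
    have : s - u ≠ 0 := (sub_pos.2 hus).ne'
    field_simp
    ring
  · refine ⟨0, fun s hs => ?_⟩
    have : s = u := le_antisymm (hs.2.trans (not_lt.1 huv)) hs.1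
    simp [this]

namespace LengthGraph

open scoped Classical

variable {V E : Type*} (Γ : LengthGraph V E)

theorem edgePoint_inner {e : E} {t : ℝ} (h0 : 0 < t) (h1 : t < Γ.len e) :
    Γ.edgePoint e t = .inner e t h0 h1 := by
  simp [edgePoint, h0, h1]

theorem edgePoint_of_nonpos (e : E) {t : ℝ} (h : t ≤ 0) :
    Γ.edgePoint e t = .vertex (Γ.src e) := by
  simp [edgePoint, not_lt.2 h]

theorem edgePoint_of_len_le (e : E) {t : ℝ} (h : Γ.len e ≤ t) :
    Γ.edgePoint e t = .vertex (Γ.tgt e) := by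
  simp [edgePoint, (Γ.len_pos e).trans_le h, not_lt.2 h]

theorem continuous_edgePoint (e : E) : Continuous (Γ.edgePoint e) :=
  continuous_iff_coinduced_le.2 (le_iSup (fun e => TopologicalSpace.coinduced (Γ.edgePoint e) _) e)

variable {Γ} in
theorem continuous_of_edges {X : Type*} [TopologicalSpace X] {f : Γ.Point → X}
    (h : ∀ e, Continuous fun t => f (Γ.edgePoint e t)) : Continuous f :=
  continuous_iSup_dom.2 fun e => continuous_coinduced_dom.2 (h e)

theorem eventually_edgePoint_ne (e : E) (t : ℝ) (y : Γ.Point) :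
    ∀ᶠ s in 𝓝 t, s ≠ t → 0 < s → s < Γ.len e → Γ.edgePoint e s ≠ y := by
  let S : Set ℝ := {s | 0 < s ∧ s < Γ.len e ∧ Γ.edgePoint e s = y}
  have hS : S.Subsingleton := by
    rintro s ⟨h1, h2, h3⟩ s' ⟨h1', h2', h3'⟩
    rw [edgePoint_inner _ h1 h2] at h3
    rw [edgePoint_inner _ h1' h2', ← h3] at h3'
    injection h3' with _ h
    exact h.symm
  have hc : IsClosed (S \ {t}) := (hS.finite.subset sdiff_subset).isClosed
  filter_upwards [hc.isOpen_compl.mem_nhds (by simp : t ∈ (S \ {t})ᶜ)] with s hs h1 h2 h3 h4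
  exact hs ⟨⟨h2, h3, h4⟩, h1⟩

/-- `f` is affine on both sides of every point of every edge, with the given slopes. -/
structure HasSlopes (f : Γ.Point → ℝ) (R L : E → ℝ → ℝ) : Prop where
  right : ∀ e t, 0 ≤ t → t < Γ.len e →
    ∀ᶠ s in 𝓝[≥] t, f (Γ.edgePoint e s) = f (Γ.edgePoint e t) + R e t * (s - t)
  left : ∀ e t, 0 < t → t ≤ Γ.len e →
    ∀ᶠ s in 𝓝[≤] t, f (Γ.edgePoint e s) = f (Γ.edgePoint e t) + L e t * (s - t)

namespace HasSlopes

variable {Γ} {f f' : Γ.Point → ℝ} {R L R' L' : E → ℝ → ℝ}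

theorem sub (h : Γ.HasSlopes f R L) (h' : Γ.HasSlopes f' R' L') :
    Γ.HasSlopes (fun x => f x - f' x) (fun e t => R e t - R' e t) (fun e t => L e t - L' e t) where
  right e t h0 h1 := by
    filter_upwards [h.right e t h0 h1, h'.right e t h0 h1] with s hs hs'
    rw [hs, hs']; ring
  left e t h0 h1 := by
    filter_upwards [h.left e t h0 h1, h'.left e t h0 h1] with s hs hs'
    rw [hs, hs']; ring

theorem add_const (h : Γ.HasSlopes f R L) (c : ℝ) : Γ.HasSlopes (fun x => f x + c) R L where
  right e t h0 h1 := by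
    filter_upwards [h.right e t h0 h1] with s hs
    rw [hs]; ring
  left e t h0 h1 := by
    filter_upwards [h.left e t h0 h1] with s hs
    rw [hs]; ring

theorem _root_.derivWithin_eq_of_eventually_affine {g : ℝ → ℝ} {s : Set ℝ} {t m : ℝ} (ht : t ∈ s)
    (hs : UniqueDiffWithinAt ℝ s t) (h : ∀ᶠ x in 𝓝[s] t, g x = g t + m * (x - t)) :
    derivWithin g s t = m := by
  have h1 : HasDerivWithinAt (fun x => g t + m * (x - t)) m s t := by
    simpa using ((((hasDerivAt_id t).sub_const t).const_mul m).const_add (g t)).hasDerivWithinAt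
  exact (h1.congr_of_eventuallyEq_of_mem h ht).derivWithin hs

theorem derivWithin_Ici (h : Γ.HasSlopes f R L) {e : E} {t : ℝ} (h0 : 0 ≤ t) (h1 : t < Γ.len e) :
    derivWithin (fun s => f (Γ.edgePoint e s)) (Ici t) t = R e t :=
  derivWithin_eq_of_eventually_affine self_mem_Ici (uniqueDiffWithinAt_Ici t) (h.right e t h0 h1)

theorem derivWithin_Iic (h : Γ.HasSlopes f R L) {e : E} {t : ℝ} (h0 : 0 < t) (h1 : t ≤ Γ.len e) :
    derivWithin (fun s => f (Γ.edgePoint e s)) (Iic t) t = L e t :=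
  derivWithin_eq_of_eventually_affine self_mem_Iic (uniqueDiffWithinAt_Iic t) (h.left e t h0 h1)

variable [Fintype E]

theorem outSlope_vertex (h : Γ.HasSlopes f R L) (p : V) :
    Γ.outSlope f (.vertex p) = ∑ e, (R e 0 * (if Γ.src e = p then 1 else 0)
      - L e (Γ.len e) * (if Γ.tgt e = p then 1 else 0)) := by
  simp only [outSlope, Finset.sum_filter, Finset.sum_sub_distrib]
  congr 1
  · refine Finset.sum_congr rfl fun e _ => ?_
    rw [h.derivWithin_Ici le_rfl (Γ.len_pos e)]
    simp
  · refine Finset.sum_congr rfl fun e _ => ?_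
    rw [h.derivWithin_Iic (Γ.len_pos e) le_rfl]
    simp

theorem outSlope_inner (h : Γ.HasSlopes f R L) (e : E) (t : ℝ) (h0 : 0 < t) (h1 : t < Γ.len e) :
    Γ.outSlope f (.inner e t h0 h1) = R e t - L e t := by
  simp only [outSlope]
  rw [h.derivWithin_Ici h0.le h1, h.derivWithin_Iic h0 h1.le]

theorem outSlope_sub (h : Γ.HasSlopes f R L) (h' : Γ.HasSlopes f' R' L') (x : Γ.Point) :
    Γ.outSlope (fun x => f x - f' x) x = Γ.outSlope f x - Γ.outSlope f' x := by
  cases x with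
  | vertex p =>
    rw [(h.sub h').outSlope_vertex, h.outSlope_vertex, h'.outSlope_vertex,
      ← Finset.sum_sub_distrib]
    exact Finset.sum_congr rfl fun e _ => by ring
  | inner e t h0 h1 =>
    rw [(h.sub h').outSlope_inner, h.outSlope_inner, h'.outSlope_inner]
    ring

theorem outSlope_add_const (h : Γ.HasSlopes f R L) (c : ℝ) (x : Γ.Point) :
    Γ.outSlope (fun x => f x + c) x = Γ.outSlope f x := by
  cases x with
  | vertex p => rw [(h.add_const c).outSlope_vertex, h.outSlope_vertex]
  | inner e t h0 h1 => rw [(h.add_const c).outSlope_inner, h.outSlope_inner]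

end HasSlopes

variable {Γ} [Fintype E]

/-- Near any parameter, `y` and `z` can occur only at the parameter itself among interior points of
the edge. Hence `f` is affine on a short interval on either side. -/
theorem IsPotential.exists_hasSlopes {z y : Γ.Point} {f : Γ.Point → ℝ} (h : Γ.IsPotential z y f) :
    ∃ R L, Γ.HasSlopes f R L := by
  have hc : ∀ e, Continuous fun t => f (Γ.edgePoint e t) := fun e =>
    h.continuous.comp (Γ.continuous_edgePoint e)
  have key : ∀ e t, ∃ δ > 0, ∀ s, |s - t| < δ → s ≠ t → 0 < s → s < Γ.len e →
      ∃ m : ℝ, ∀ᶠ s' in 𝓝 s, f (Γ.edgePoint e s') = f (Γ.edgePoint e s) + m * (s' - s) := by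
    intro e t
    obtain ⟨δ, hδ, hb⟩ := Metric.eventually_nhds_iff.1
      ((Γ.eventually_edgePoint_ne e t y).and (Γ.eventually_edgePoint_ne e t z))
    refine ⟨δ, hδ, fun s h1 h2 h3 h4 => ?_⟩
    obtain ⟨hy, hz⟩ := hb (by rwa [Real.dist_eq])
    exact h.affine e s h3 h4 (hy h2 h3 h4) (hz h2 h3 h4)
  have hr : ∀ e t, ∃ m : ℝ, 0 ≤ t → t < Γ.len e →
      ∀ᶠ s in 𝓝[≥] t, f (Γ.edgePoint e s) = f (Γ.edgePoint e t) + m * (s - t) := by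
    intro e t
    by_cases ht : 0 ≤ t ∧ t < Γ.len e
    swap
    · exact ⟨0, fun h0 h1 => absurd ⟨h0, h1⟩ ht⟩
    obtain ⟨δ, hδ, hk⟩ := key e t
    have htv : t < min (t + δ) (Γ.len e) := lt_min (by linarith) ht.2
    obtain ⟨m, hm⟩ := exists_affine_Icc (f := fun t => f (Γ.edgePoint e t)) (u := t)
      (v := min (t + δ) (Γ.len e)) (hc e).continuousOn (by
        rintro s ⟨h1, h2⟩
        obtain ⟨h2, h3⟩ := lt_min_iff.1 h2
        exact hk s (by rw [abs_of_pos] <;> linarith) h1.ne' (ht.1.trans_lt h1) h3)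
    refine ⟨m, fun _ _ => ?_⟩
    filter_upwards [Icc_mem_nhdsGE htv] with s hs
    exact hm s hs
  have hl : ∀ e t, ∃ m : ℝ, 0 < t → t ≤ Γ.len e →
      ∀ᶠ s in 𝓝[≤] t, f (Γ.edgePoint e s) = f (Γ.edgePoint e t) + m * (s - t) := by
    intro e t
    by_cases ht : 0 < t ∧ t ≤ Γ.len e
    swap
    · exact ⟨0, fun h0 h1 => absurd ⟨h0, h1⟩ ht⟩
    obtain ⟨δ, hδ, hk⟩ := key e t
    have htv : max (t - δ) 0 < t := max_lt (by linarith) ht.1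
    obtain ⟨m, hm⟩ := exists_affine_Icc (f := fun t => f (Γ.edgePoint e t)) (u := max (t - δ) 0)
      (v := t) (hc e).continuousOn (by
        rintro s ⟨h1, h2⟩
        obtain ⟨h1, h3⟩ := max_lt_iff.1 h1
        exact hk s (by rw [abs_of_neg] <;> linarith) h2.ne h3 (h2.trans_le ht.2))
    refine ⟨m, fun _ _ => ?_⟩
    filter_upwards [Icc_mem_nhdsLE htv] with s hs
    have h1 := hm s hs
    have h2 := hm t ⟨htv.le, le_rfl⟩
    rw [h1, h2]; ring
  choose R hR using hr
  choose L hL using hl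
  exact ⟨R, L, hR, hL⟩

variable [Fintype V]

/-- The difference of two potentials has no slope jumps, so it is affine on whole edges and its
restriction to the vertices is harmonic. It is therefore constant, and it vanishes at `z`. -/
theorem IsPotential.unique (hΓ : Γ.Connected) {z y : Γ.Point} {f f' : Γ.Point → ℝ}
    (h : Γ.IsPotential z y f) (h' : Γ.IsPotential z y f') : f = f' := by
  obtain ⟨R, L, hs⟩ := h.exists_hasSlopes
  obtain ⟨R', L', hs'⟩ := h'.exists_hasSlopes
  have hd := hs.sub hs'
  have hout : ∀ x, Γ.outSlope (fun x => f x - f' x) x = 0 := fun x => by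
    have h1 := h.laplacian x
    have h2 := h'.laplacian x
    rw [hs.outSlope_sub hs']
    linarith
  set d : Γ.Point → ℝ := fun x => f x - f' x with hd_def
  have hdc : Continuous d := h.continuous.sub h'.continuous
  have haff : ∀ e, ∃ m : ℝ, ∀ s ∈ Icc 0 (Γ.len e),
      d (Γ.edgePoint e s) = d (Γ.edgePoint e 0) + m * (s - 0) := by
    intro e
    refine exists_affine_Icc (f := fun s => d (Γ.edgePoint e s))
      (hdc.comp (Γ.continuous_edgePoint e)).continuousOn fun t ht => ?_
    have h1 := hd.outSlope_inner e t ht.1 ht.2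
    rw [hout] at h1
    refine ⟨R e t - R' e t, ?_⟩
    have h2 := hd.right e t ht.1.le ht.2
    have h3 := hd.left e t ht.1 ht.2.le
    rw [← sub_eq_zero.1 h1.symm] at h3
    rw [← nhdsLE_sup_nhdsGE, Filter.eventually_sup]
    exact ⟨h3, h2⟩
  choose m hm using haff
  have hm' : ∀ e t, 0 ≤ t → t ≤ Γ.len e → ∀ s, 0 ≤ s → s ≤ Γ.len e →
      d (Γ.edgePoint e s) = d (Γ.edgePoint e t) + m e * (s - t) := by
    intro e t h0 h1 s h2 h3
    rw [hm e s ⟨h2, h3⟩, hm e t ⟨h0, h1⟩]; ring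
  have hslope : Γ.HasSlopes d (fun e _ => m e) (fun e _ => m e) :=
    { right := fun e t h0 h1 => by
        filter_upwards [Icc_mem_nhdsGE h1] with s hs
        exact hm' e t h0 h1.le s (h0.trans hs.1) hs.2
      left := fun e t h0 h1 => by
        filter_upwards [Icc_mem_nhdsLE h0] with s hs
        exact hm' e t h0.le h1 s hs.1 (hs.2.trans h1) }
  have hme : ∀ e, d (.vertex (Γ.tgt e)) = d (.vertex (Γ.src e)) + m e * Γ.len e := by
    intro e
    have := hm' e 0 le_rfl (Γ.len_pos e).le (Γ.len e) (Γ.len_pos e).le le_rfl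
    rwa [edgePoint_of_nonpos _ _ le_rfl, edgePoint_of_len_le _ _ le_rfl, sub_zero] at this
  have hlap : ∀ q, Γ.lap (fun p => d (.vertex p)) q = 0 := by
    intro q
    have h1 := hslope.outSlope_vertex q
    rw [hout] at h1
    rw [← neg_eq_zero, h1, lap, ← Finset.sum_neg_distrib]
    refine Finset.sum_congr rfl fun e _ => ?_
    have := (Γ.len_pos e).ne'
    rw [hme e]
    field_simp
    ring
  have hc := Γ.eq_of_lap_eq_zero hΓ _ hlap
  have hm0 : ∀ e, m e = 0 := by
    intro e
    have h1 := hme e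
    rw [hc (Γ.tgt e) (Γ.src e)] at h1
    have := (Γ.len_pos e).ne'
    simpa [this] using h1
  have hv : ∀ p, ∀ x, d x = d (.vertex p) := by
    intro p x
    cases x with
    | vertex q => exact hc q p
    | inner e t h0 h1 =>
      have := hm' e 0 le_rfl (Γ.len_pos e).le t h0.le h1.le
      rw [edgePoint_inner _ h0 h1, edgePoint_of_nonpos _ _ le_rfl, hm0, zero_mul, add_zero] at this
      rw [this]
      exact hc _ p
  obtain ⟨p⟩ := hΓ.1
  have hz : d z = 0 := by simp only [hd_def, h.base, h'.base, sub_zero]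
  funext x
  have : d x = 0 := by rw [hv p x, ← hv p z, hz]
  exact sub_eq_zero.1 this

end LengthGraph

/-! ### The Green function on the realization; voltages and edge densities. -/

namespace LengthGraph

open scoped Classical

variable {V E : Type*} (Γ : LengthGraph V E)

/-- The extension of a function on the vertices which is affine on every edge. -/
def interp (f : V → ℝ) : Γ.Point → ℝ
  | .vertex p => f p
  | .inner e t _ _ => f (Γ.src e) + t / Γ.len e * (f (Γ.tgt e) - f (Γ.src e))

/-- The Green function of the disjoint union of the edges with Dirichlet boundary conditions. -/
def bump : Γ.Point → Γ.Point → ℝ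
  | .inner e t _ _, .inner e' s _ _ => if e = e' then min t s - t * s / Γ.len e else 0
  | _, _ => 0

/-- The extension to the realization of a Green function on the vertices. -/
def green (G : V → V → ℝ) (x y : Γ.Point) : ℝ :=
  Γ.interp (fun p => Γ.interp (G p) y) x + Γ.bump x y

/-- The retraction of the line onto the parameter interval of an edge. -/
def clamp (e : E) (t : ℝ) : ℝ := max 0 (min t (Γ.len e))

theorem clamp_of_mem {e : E} {t : ℝ} (h0 : 0 ≤ t) (h1 : t ≤ Γ.len e) : Γ.clamp e t = t := by
  simp [clamp, h0, h1]

theorem clamp_of_nonpos (e : E) {t : ℝ} (h : t ≤ 0) : Γ.clamp e t = 0 := by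
  simp [clamp, h]

theorem clamp_of_len_le (e : E) {t : ℝ} (h : Γ.len e ≤ t) : Γ.clamp e t = Γ.len e := by
  simp [clamp, h, (Γ.len_pos e).le]

theorem continuous_clamp (e : E) : Continuous (Γ.clamp e) := by
  unfold clamp; fun_prop

theorem edgePoint_cases (e : E) (t : ℝ) : t ≤ 0 ∨ Γ.len e ≤ t ∨ (0 < t ∧ t < Γ.len e) := by
  by_cases h0 : t ≤ 0
  · exact Or.inl h0
  by_cases h1 : Γ.len e ≤ t
  · exact Or.inr (Or.inl h1)
  · exact Or.inr (Or.inr ⟨not_le.1 h0, not_le.1 h1⟩)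

theorem interp_edgePoint (f : V → ℝ) (e : E) (t : ℝ) : Γ.interp f (Γ.edgePoint e t) =
    f (Γ.src e) + Γ.clamp e t / Γ.len e * (f (Γ.tgt e) - f (Γ.src e)) := by
  obtain h | h | ⟨h0, h1⟩ := Γ.edgePoint_cases e t
  · rw [edgePoint_of_nonpos _ _ h, clamp_of_nonpos _ _ h]; simp [interp]
  · rw [edgePoint_of_len_le _ _ h, clamp_of_len_le _ _ h, div_self (Γ.len_pos e).ne']
    simp [interp]
  · rw [edgePoint_inner _ h0 h1, clamp_of_mem _ h0.le h1.le]; rfl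

@[simp] theorem bump_vertex_left (p : V) (y : Γ.Point) : Γ.bump (.vertex p) y = 0 := rfl

@[simp] theorem bump_vertex_right (p : V) (x : Γ.Point) : Γ.bump x (.vertex p) = 0 := by
  cases x <;> rfl

theorem bump_edgePoint_inner (e e' : E) (t s : ℝ) (h0 : 0 < s) (h1 : s < Γ.len e') :
    Γ.bump (Γ.edgePoint e t) (.inner e' s h0 h1) =
      if e = e' then min (Γ.clamp e t) s - Γ.clamp e t * s / Γ.len e else 0 := by
  obtain h | h | ⟨h2, h3⟩ := Γ.edgePoint_cases e t
  · rw [edgePoint_of_nonpos _ _ h, clamp_of_nonpos _ _ h]; simp [h0.le]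
  · rw [edgePoint_of_len_le _ _ h, clamp_of_len_le _ _ h]
    split_ifs with he
    · subst he
      have := (Γ.len_pos e).ne'
      rw [bump_vertex_left, min_eq_right h1.le]
      field_simp
      ring
    · simp
  · rw [edgePoint_inner _ h2 h3, clamp_of_mem _ h2.le h3.le]; rfl

theorem bump_comm (x y : Γ.Point) : Γ.bump x y = Γ.bump y x := by
  cases x with
  | vertex p => simp
  | inner e t h0 h1 =>
    cases y with
    | vertex p => simp
    | inner e' s h2 h3 =>
      simp only [bump]
      by_cases h : e = e'
      · subst h; rw [if_pos rfl, if_pos rfl, min_comm, mul_comm]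
      · rw [if_neg h, if_neg (Ne.symm h)]

theorem bump_edgePoint_self (e : E) (t : ℝ) :
    Γ.bump (Γ.edgePoint e t) (Γ.edgePoint e t) =
      Γ.clamp e t - Γ.clamp e t * Γ.clamp e t / Γ.len e := by
  obtain h | h | ⟨h2, h3⟩ := Γ.edgePoint_cases e t
  · rw [edgePoint_of_nonpos _ _ h, clamp_of_nonpos _ _ h]; simp
  · rw [edgePoint_of_len_le _ _ h, clamp_of_len_le _ _ h]
    have := (Γ.len_pos e).ne'
    simp [this]
  · rw [edgePoint_inner _ h2 h3, clamp_of_mem _ h2.le h3.le]; simp [bump]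

variable {Γ} in
theorem interp_interp_comm {G : V → V → ℝ} (hG : ∀ p q, G p q = G q p) (x y : Γ.Point) :
    Γ.interp (fun p => Γ.interp (G p) y) x = Γ.interp (fun p => Γ.interp (G p) x) y := by
  cases x with
  | vertex p =>
    cases y with
    | vertex q => exact hG p q
    | inner e s _ _ => simp only [interp, hG p]
  | inner e t _ _ =>
    cases y with
    | vertex q => simp only [interp, hG _ q]
    | inner e' s _ _ => simp only [interp, hG (Γ.src e'), hG (Γ.tgt e')]; ring

variable {Γ} in
theorem green_comm {G : V → V → ℝ} (hG : ∀ p q, G p q = G q p) (x y : Γ.Point) :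
    Γ.green G x y = Γ.green G y x := by
  rw [green, green, interp_interp_comm hG, bump_comm]

theorem green_vertex_left (G : V → V → ℝ) (p : V) (y : Γ.Point) :
    Γ.green G (.vertex p) y = Γ.interp (G p) y := by
  simp [green, interp]

theorem continuous_green_left (G : V → V → ℝ) (y : Γ.Point) :
    Continuous fun x => Γ.green G x y := by
  refine continuous_of_edges fun e => ?_
  have := Γ.continuous_clamp e
  simp only [green, interp_edgePoint]
  cases y with
  | vertex p => simp only [bump_vertex_right]; fun_prop
  | inner e' s h0 h1 =>
    simp only [bump_edgePoint_inner]
    split_ifs <;> fun_prop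

theorem green_edgePoint_self (G : V → V → ℝ) (e : E) (t : ℝ) :
    Γ.green G (Γ.edgePoint e t) (Γ.edgePoint e t) =
      (1 - Γ.clamp e t / Γ.len e) ^ 2 * G (Γ.src e) (Γ.src e)
      + (1 - Γ.clamp e t / Γ.len e) * (Γ.clamp e t / Γ.len e) *
        (G (Γ.src e) (Γ.tgt e) + G (Γ.tgt e) (Γ.src e))
      + (Γ.clamp e t / Γ.len e) ^ 2 * G (Γ.tgt e) (Γ.tgt e)
      + (Γ.clamp e t - Γ.clamp e t * Γ.clamp e t / Γ.len e) := by
  simp only [green, interp_edgePoint, bump_edgePoint_self]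
  ring

theorem continuous_green_self (G : V → V → ℝ) : Continuous fun x => Γ.green G x x := by
  refine continuous_of_edges fun e => ?_
  have := Γ.continuous_clamp e
  simp only [green_edgePoint_self]
  fun_prop

/-- The right slopes of `bump · y`. -/
def bumpRight : Γ.Point → E → ℝ → ℝ
  | .vertex _, _, _ => 0
  | .inner e' s _ _, e, t => if e = e' then (if t < s then 1 else 0) - s / Γ.len e else 0

/-- The left slopes of `bump · y`. -/
def bumpLeft : Γ.Point → E → ℝ → ℝ
  | .vertex _, _, _ => 0
  | .inner e' s _ _, e, t => if e = e' then (if t ≤ s then 1 else 0) - s / Γ.len e else 0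

theorem hasSlopes_green (G : V → V → ℝ) (y : Γ.Point) : Γ.HasSlopes (fun x => Γ.green G x y)
    (fun e t => (Γ.interp (G (Γ.tgt e)) y - Γ.interp (G (Γ.src e)) y) / Γ.len e
      + Γ.bumpRight y e t)
    (fun e t => (Γ.interp (G (Γ.tgt e)) y - Γ.interp (G (Γ.src e)) y) / Γ.len e
      + Γ.bumpLeft y e t) where
  right e t h0 h1 := by
    cases y with
    | vertex p =>
      filter_upwards [Icc_mem_nhdsGE h1] with s hs
      simp only [green, interp_edgePoint, bump_vertex_right, bumpRight,
        Γ.clamp_of_mem h0 h1.le, Γ.clamp_of_mem (h0.trans hs.1) hs.2]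
      ring
    | inner e' u h2 h3 =>
      have hmin : ∀ᶠ s in 𝓝[≥] t, min s u = min t u + (if t < u then 1 else 0) * (s - t) := by
        split_ifs with htu
        · filter_upwards [Icc_mem_nhdsGE htu] with s hs
          rw [min_eq_left hs.2, min_eq_left htu.le]; ring
        · filter_upwards [self_mem_nhdsWithin] with s hs
          rw [min_eq_right (not_lt.1 htu), min_eq_right ((not_lt.1 htu).trans hs)]; ring
      filter_upwards [Icc_mem_nhdsGE h1, hmin] with s hs hm
      simp only [green, interp_edgePoint, bump_edgePoint_inner, bumpRight,
        Γ.clamp_of_mem h0 h1.le, Γ.clamp_of_mem (h0.trans hs.1) hs.2, hm]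
      split_ifs <;> ring
  left e t h0 h1 := by
    cases y with
    | vertex p =>
      filter_upwards [Icc_mem_nhdsLE h0] with s hs
      simp only [green, interp_edgePoint, bump_vertex_right, bumpLeft,
        Γ.clamp_of_mem h0.le h1, Γ.clamp_of_mem hs.1 (hs.2.trans h1)]
      ring
    | inner e' u h2 h3 =>
      have hmin : ∀ᶠ s in 𝓝[≤] t, min s u = min t u + (if t ≤ u then 1 else 0) * (s - t) := by
        split_ifs with htu
        · filter_upwards [self_mem_nhdsWithin] with s hs
          rw [min_eq_left htu, min_eq_left (le_trans hs htu)]; ring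
        · filter_upwards [Icc_mem_nhdsLE (not_le.1 htu)] with s hs
          rw [min_eq_right (not_le.1 htu).le, min_eq_right hs.1]; ring
      filter_upwards [Icc_mem_nhdsLE h0, hmin] with s hs hm
      simp only [green, interp_edgePoint, bump_edgePoint_inner, bumpLeft,
        Γ.clamp_of_mem h0.le h1, Γ.clamp_of_mem hs.1 (hs.2.trans h1), hm]
      split_ifs <;> ring

/-- The only kink of `bump` in the interior of an edge is at `y`. -/
theorem bumpRight_eq_bumpLeft {y : Γ.Point} {e : E} {t : ℝ} (h : Γ.edgePoint e t ≠ y) :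
    Γ.bumpRight y e t = Γ.bumpLeft y e t := by
  cases y with
  | vertex p => rfl
  | inner e' s h0 h1 =>
    simp only [bumpRight, bumpLeft]
    split_ifs with h1 h2 h3 h3
    · rfl
    · exact absurd h2.le h3
    · subst h1
      have : t = s := le_antisymm h3 (not_lt.1 h2)
      subst this
      exact absurd (Γ.edgePoint_inner _ _) h
    · rfl
    · rfl

variable [Fintype E] [Fintype V]

variable {Γ} {G : V → V → ℝ}

namespace IsGreen

/-- The background charge -1/#V at each vertex is independent of `y`, so it disappears in the
difference of two such functions; this is how `isPotential` uses it. -/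
theorem outSlope_green (hG : Γ.IsGreen G) (y x : Γ.Point) :
    -Γ.outSlope (fun x => Γ.green G x y) x = (if x = y then 1 else 0) -
      (match x with | .vertex _ => 1 / (Fintype.card V : ℝ) | .inner _ _ _ _ => 0) := by
  cases x with
  | inner e t h0 h1 =>
    rw [(Γ.hasSlopes_green G y).outSlope_inner]
    cases y with
    | vertex p => simp [bumpRight, bumpLeft]
    | inner e' s h2 h3 =>
      simp only [bumpRight, bumpLeft, Point.inner.injEq]
      by_cases he : e = e'
      · subst he
        rcases lt_trichotomy t s with h | h | h
        · simp [h, h.le, h.ne]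
        · simp [h]
        · simp [h.not_gt, h.not_ge, h.ne']
      · simp [he]
  | vertex q =>
    rw [(Γ.hasSlopes_green G y).outSlope_vertex]
    cases y with
    | vertex p =>
      have h := hG.lap_eq p q
      have h2 : Γ.lap (G p) q = -∑ e, (((Γ.interp (G (Γ.tgt e)) (.vertex p) -
          Γ.interp (G (Γ.src e)) (.vertex p)) / Γ.len e + Γ.bumpRight (.vertex p) e 0) *
            (if Γ.src e = q then 1 else 0) -
          ((Γ.interp (G (Γ.tgt e)) (.vertex p) - Γ.interp (G (Γ.src e)) (.vertex p)) / Γ.len e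
            + Γ.bumpLeft (.vertex p) e (Γ.len e)) * (if Γ.tgt e = q then 1 else 0)) := by
        rw [lap, ← Finset.sum_neg_distrib]
        refine Finset.sum_congr rfl fun e _ => ?_
        simp only [interp, bumpRight, bumpLeft, hG.symm p]
        ring
      rw [← h2, h]
      simp only [Point.vertex.injEq, eq_comm]
    | inner e₀ s h0 h1 =>
      have hl := (Γ.len_pos e₀).ne'
      have ha := hG.lap_eq (Γ.src e₀) q
      have hb := hG.lap_eq (Γ.tgt e₀) q
      -- Interpolation splits the unit source into masses 1 - s/L and s/L at the ends of `e₀`. The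
      -- end slopes of `bump` cancel exactly these masses, leaving the source at the interior point.
      have h2 : (1 - s / Γ.len e₀) * Γ.lap (G (Γ.src e₀)) q +
          s / Γ.len e₀ * Γ.lap (G (Γ.tgt e₀)) q -
          ∑ e, (if e = e₀ then (1 - s / Γ.len e₀) * (if Γ.src e₀ = q then 1 else 0) +
            s / Γ.len e₀ * (if Γ.tgt e₀ = q then 1 else 0) else 0) =
          -∑ e, (((Γ.interp (G (Γ.tgt e)) (.inner e₀ s h0 h1) -
          Γ.interp (G (Γ.src e)) (.inner e₀ s h0 h1)) / Γ.len e +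
            Γ.bumpRight (.inner e₀ s h0 h1) e 0) * (if Γ.src e = q then 1 else 0) -
          ((Γ.interp (G (Γ.tgt e)) (.inner e₀ s h0 h1) -
            Γ.interp (G (Γ.src e)) (.inner e₀ s h0 h1)) / Γ.len e
            + Γ.bumpLeft (.inner e₀ s h0 h1) e (Γ.len e)) * (if Γ.tgt e = q then 1 else 0)) := by
        rw [lap, lap, ← Finset.sum_neg_distrib, Finset.mul_sum, Finset.mul_sum,
          ← Finset.sum_add_distrib, ← Finset.sum_sub_distrib]
        refine Finset.sum_congr rfl fun e _ => ?_
        simp only [interp, bumpRight, bumpLeft, hG.symm (Γ.src e₀), hG.symm (Γ.tgt e₀)]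
        by_cases he : e = e₀
        · subst he
          simp only [if_true, if_pos h0, if_neg (not_le.2 h1)]
          ring
        · simp only [he, if_false]
          ring
      rw [← h2, ha, hb, Finset.sum_ite_eq', if_pos (Finset.mem_univ _)]
      simp only [reduceCtorEq, if_false]
      ring

theorem isPotential (hG : Γ.IsGreen G) (z y : Γ.Point) : Γ.IsPotential z y
    (fun x => Γ.green G x y - Γ.green G x z + (Γ.green G z z - Γ.green G z y)) where
  continuous := by
    have h1 := Γ.continuous_green_left G y
    have h2 := Γ.continuous_green_left G z
    fun_prop
  base := by ring
  affine e t h0 h1 hy hz := by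
    have h := ((Γ.hasSlopes_green G y).sub (Γ.hasSlopes_green G z)).add_const
      (Γ.green G z z - Γ.green G z y)
    have hr := h.right e t h0.le h1
    have hl := h.left e t h0 h1.le
    rw [Γ.bumpRight_eq_bumpLeft hy, Γ.bumpRight_eq_bumpLeft hz] at hr
    have := Filter.eventually_sup.2 ⟨hl, hr⟩
    rw [nhdsLE_sup_nhdsGE] at this
    exact ⟨_, this⟩
  laplacian x := by
    have h1 := Γ.hasSlopes_green G y
    have h2 := Γ.hasSlopes_green G z
    rw [(h1.sub h2).outSlope_add_const, h1.outSlope_sub h2]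
    have h3 := hG.outSlope_green y x
    have h4 := hG.outSlope_green z x
    linarith

theorem voltage_eq (hG : Γ.IsGreen G) (hΓ : Γ.Connected) (z x y : Γ.Point) :
    Γ.voltage z x y = Γ.green G x y - Γ.green G x z + (Γ.green G z z - Γ.green G z y) := by
  have h : ∃ f, Γ.IsPotential z y f := ⟨_, hG.isPotential z y⟩
  rw [voltage, dif_pos h]
  exact congrFun (h.choose_spec.unique hΓ (hG.isPotential z y)) x

theorem resistance_eq (hG : Γ.IsGreen G) (hΓ : Γ.Connected) (x y : Γ.Point) :
    Γ.resistance x y = Γ.green G x x + Γ.green G y y - 2 * Γ.green G x y := by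
  rw [resistance, hG.voltage_eq hΓ, green_comm hG.symm y x]
  ring

theorem resistance_vertex (hG : Γ.IsGreen G) (hΓ : Γ.Connected) (p q : V) :
    Γ.resistance (.vertex p) (.vertex q) = res G p q := by
  rw [hG.resistance_eq hΓ]
  simp [green, interp, res]

theorem resistance_comm (hG : Γ.IsGreen G) (hΓ : Γ.Connected) (x y : Γ.Point) :
    Γ.resistance x y = Γ.resistance y x := by
  rw [hG.resistance_eq hΓ, hG.resistance_eq hΓ, green_comm hG.symm y x]
  ring

theorem continuous_resistance (hG : Γ.IsGreen G) (hΓ : Γ.Connected) (x : Γ.Point) :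
    Continuous fun y => Γ.resistance x y := by
  simp only [hG.resistance_eq hΓ, green_comm hG.symm x]
  have h1 := Γ.continuous_green_left G x
  have h2 := Γ.continuous_green_self G
  fun_prop

/-- The relation between the conductance of an edge and the resistance in the graph without it. -/
theorem edgeDensity_eq (hG : Γ.IsGreen G) (hΓ : Γ.Connected) (e : E) :
    Γ.edgeDensity e = (Γ.len e - res G (Γ.src e) (Γ.tgt e)) / Γ.len e ^ 2 ∧
      0 ≤ Γ.edgeDensity e := by
  have hl := Γ.len_pos e
  have hlap : ∀ (f : V → ℝ) (q : V), Γ.lap f q = (Γ.delete e).lap f q +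
      (f (Γ.src e) - f (Γ.tgt e)) / Γ.len e *
        ((if Γ.src e = q then 1 else 0) - (if Γ.tgt e = q then 1 else 0)) := by
    intro f q
    rw [lap, lap, Fintype.sum_eq_add_sum_subtype_ne _ e, add_comm]
    rfl
  by_cases hc : (Γ.delete e).Connected
  · obtain ⟨G', hG'⟩ := (Γ.delete e).exists_isGreen hc
    rw [edgeDensity, if_pos hc]
    have h0 := hG'.res_nonneg (Γ.src e) (Γ.tgt e)
    have hR₀ := hG'.resistance_vertex hc (Γ.src e) (Γ.tgt e)
    have hR : ∀ i : Fintype {e' : E // e' ≠ e},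
        @resistance V {e' : E // e' ≠ e} i (Γ.delete e) (.vertex (Γ.src e)) (.vertex (Γ.tgt e)) =
        res G' (Γ.src e) (Γ.tgt e) := by
      intro i
      convert hR₀
    rw [hR]
    set R := res G' (Γ.src e) (Γ.tgt e) with hRdef
    refine ⟨?_, by positivity⟩
    let u : V → ℝ := fun x => G' (Γ.src e) x - G' (Γ.tgt e) x
    have hu : u (Γ.src e) - u (Γ.tgt e) = R := by
      simp only [u, hRdef, res, hG'.symm (Γ.tgt e) (Γ.src e)]; ring
    -- `u` drives a unit current through Γ - e with potential drop R; restoring `e` adds the current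
    -- R/L. Hence R = (1 + R/L) r in Γ, which is the parallel law.
    have hlu : ∀ q, Γ.lap u q = (1 + R / Γ.len e) *
        ((if Γ.src e = q then 1 else 0) - (if Γ.tgt e = q then 1 else 0)) := by
      intro q
      rw [hlap, hu, (Γ.delete e).lap_sub, hG'.lap_eq, hG'.lap_eq]
      ring
    have h1 := hG.sub_eq_mul_res u _ _ _ hlu
    rw [hu] at h1
    have h2 : res G (Γ.src e) (Γ.tgt e) = R * Γ.len e / (Γ.len e + R) := by
      have : Γ.len e + R ≠ 0 := by positivity
      field_simp at h1 ⊢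
      linarith
    rw [h2]
    have : Γ.len e + R ≠ 0 := by positivity
    field_simp
    ring
  · rw [edgeDensity, if_neg hc]
    refine ⟨?_, le_rfl⟩
    -- For a bridge, `S` is the side of its source. The potential equal to L on `S` and 0 elsewhere
    -- carries unit current, so r = L and the formula gives 0.
    let S : V → Prop := fun x => Relation.ReflTransGen (Γ.delete e).Adj (Γ.src e) x
    have hsymm : ∀ p q, (Γ.delete e).Adj p q → (Γ.delete e).Adj q p := by
      rintro p q ⟨e', h | h⟩
      · exact ⟨e', Or.inr h⟩
      · exact ⟨e', Or.inl h⟩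
    have hrsymm : ∀ p q, Relation.ReflTransGen (Γ.delete e).Adj p q →
        Relation.ReflTransGen (Γ.delete e).Adj q p := by
      intro p q h
      induction h with
      | refl => exact .refl
      | tail _ h2 ih => exact .head (hsymm _ _ h2) ih
    have hS : ∀ e', e' ≠ e → (S (Γ.src e') ↔ S (Γ.tgt e')) := by
      intro e' he'
      have hadj : (Γ.delete e).Adj (Γ.src e') (Γ.tgt e') := ⟨⟨e', he'⟩, Or.inl ⟨rfl, rfl⟩⟩
      exact ⟨fun h => h.tail hadj, fun h => h.tail (hsymm _ _ hadj)⟩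
    have hb : ¬ S (Γ.tgt e) := by
      intro hb
      have hall : ∀ x, S x := by
        intro x
        have := Γ.eq_of_forall_edge hΓ S (fun e' => by
          by_cases he' : e' = e
          · subst he'
            exact propext ⟨fun _ => hb, fun _ => .refl⟩
          · exact propext (hS e' he')) x (Γ.src e)
        rw [this]
      exact hc ⟨hΓ.1, fun p q => (hrsymm _ _ (hall p)).trans (hall q)⟩
    let u : V → ℝ := fun x => if S x then Γ.len e else 0
    have hu : u (Γ.src e) - u (Γ.tgt e) = Γ.len e := by
      have ha : S (Γ.src e) := .refl
      simp only [u, if_pos ha, if_neg hb, sub_zero]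
    have hlu : ∀ q, Γ.lap u q = 1 *
        ((if Γ.src e = q then 1 else 0) - (if Γ.tgt e = q then 1 else 0)) := by
      intro q
      have : (Γ.delete e).lap u q = 0 := by
        refine Finset.sum_eq_zero fun e' _ => ?_
        have h1 : u ((Γ.delete e).src e') = u ((Γ.delete e).tgt e') := by
          simp only [u]
          exact if_congr (hS e' e'.2) rfl rfl
        rw [h1, sub_self, zero_div, zero_mul]
      rw [hlap, hu, this, div_self hl.ne', zero_add]
    have h1 := hG.sub_eq_mul_res u _ _ _ hlu
    rw [hu, one_mul] at h1
    rw [← h1, sub_self, zero_div]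

end IsGreen

end LengthGraph

/-! ### The canonical measure and the pointwise length bound. -/

theorem integral_min_eq {s L : ℝ} (h0 : 0 ≤ s) (h1 : s ≤ L) :
    ∫ t in (0 : ℝ)..L, min t s = s * L - s ^ 2 / 2 := by
  have hc : Continuous fun t : ℝ => min t s := by fun_prop
  rw [← intervalIntegral.integral_add_adjacent_intervals (hc.intervalIntegrable 0 s)
    (hc.intervalIntegrable s L)]
  have h2 : ∫ t in (0 : ℝ)..s, min t s = ∫ t in (0 : ℝ)..s, t :=
    intervalIntegral.integral_congr fun t ht => by
      rw [uIcc_of_le h0] at ht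
      exact min_eq_left ht.2
  have h3 : ∫ t in s..L, min t s = ∫ t in s..L, s :=
    intervalIntegral.integral_congr fun t ht => by
      rw [uIcc_of_le h1] at ht
      exact min_eq_right ht.1
  rw [h2, h3, integral_id, intervalIntegral.integral_const, smul_eq_mul]
  ring

theorem integral_quadratic_add_min {s L : ℝ} (h0 : 0 ≤ s) (h1 : s ≤ L) (a b c d : ℝ) :
    ∫ t in (0 : ℝ)..L, (a + b * t + c * t ^ 2 + d * min t s) =
      a * L + b * L ^ 2 / 2 + c * L ^ 3 / 3 + d * (s * L - s ^ 2 / 2) := by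
  have hi : ∀ f : ℝ → ℝ, Continuous f → IntervalIntegrable f volume 0 L :=
    fun f hf => hf.intervalIntegrable 0 L
  rw [intervalIntegral.integral_add (hi _ (by fun_prop)) (hi _ (by fun_prop)),
    intervalIntegral.integral_add (hi _ (by fun_prop)) (hi _ (by fun_prop)),
    intervalIntegral.integral_add (hi _ (by fun_prop)) (hi _ (by fun_prop)),
    intervalIntegral.integral_const, intervalIntegral.integral_const_mul,
    intervalIntegral.integral_const_mul, intervalIntegral.integral_const_mul,
    integral_min_eq h0 h1, integral_id, integral_pow, smul_eq_mul]
  norm_num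
  ring

namespace LengthGraph

open scoped Classical

variable {V E : Type*} (Γ : LengthGraph V E)

/-- The integral of `bump x ·` over the edge `e`. -/
def bumpInt : Γ.Point → E → ℝ
  | .vertex _, _ => 0
  | .inner e' s _ _, e => if e = e' then s * (Γ.len e - s) / 2 else 0

variable [Fintype E]

/-- The integral of a function over `Γ` with respect to the canonical measure
`∑ p, (1 - v(p) / 2) δ_p + ∑ e, dx / (L_e + R_e)`. -/
def canonInt [Fintype V] (f : Γ.Point → ℝ) : ℝ :=
  ∑ p, (1 - (Γ.valence p : ℝ) / 2) * f (.vertex p) +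
    ∑ e, Γ.edgeDensity e * ∫ t in (0 : ℝ)..Γ.len e, f (Γ.edgePoint e t)

theorem valence_eq_sum (p : V) : (Γ.valence p : ℝ) =
    ∑ e, ((if Γ.src e = p then 1 else 0) + (if Γ.tgt e = p then 1 else 0)) := by
  simp [valence, Finset.sum_add_distrib]

variable [Fintype V]

theorem sum_valence_mul (f : V → ℝ) :
    ∑ p, (Γ.valence p : ℝ) * f p = ∑ e, (f (Γ.src e) + f (Γ.tgt e)) := by
  simp only [valence_eq_sum, Finset.sum_mul]
  rw [Finset.sum_comm]
  refine Finset.sum_congr rfl fun e _ => ?_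
  simp only [add_mul, ite_mul, one_mul, zero_mul, Finset.sum_add_distrib, Finset.sum_ite_eq,
    Finset.mem_univ, if_true]

variable {Γ} {G : V → V → ℝ}

namespace IsGreen

theorem integral_edge_resistance (hG : Γ.IsGreen G) (hΓ : Γ.Connected) (x : Γ.Point) (e : E) :
    ∫ t in (0 : ℝ)..Γ.len e, Γ.resistance x (Γ.edgePoint e t) =
      Γ.len e * (Γ.green G x x + (G (Γ.src e) (Γ.src e) + G (Γ.tgt e) (Γ.tgt e)) / 2
        - (Γ.interp (G (Γ.src e)) x + Γ.interp (G (Γ.tgt e)) x))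
      + Γ.edgeDensity e * Γ.len e ^ 3 / 6 - 2 * Γ.bumpInt x e := by
  have hl := Γ.len_pos e
  -- Treats all positions of `x` together: c = 1 when `x` is interior to `e`, and c = 0 otherwise.
  have hb : ∃ s c : ℝ, 0 ≤ s ∧ s ≤ Γ.len e ∧ Γ.bumpInt x e = c * (s * (Γ.len e - s) / 2) ∧
      ∀ t, Γ.bump (Γ.edgePoint e t) x =
        c * (min (Γ.clamp e t) s - Γ.clamp e t * s / Γ.len e) := by
    cases x with
    | vertex p => exact ⟨0, 0, le_rfl, hl.le, by simp [bumpInt], by simp⟩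
    | inner e' s h0 h1 =>
      by_cases he : e = e'
      · subst he
        exact ⟨s, 1, h0.le, h1.le, by simp [bumpInt], by simp [bump_edgePoint_inner]⟩
      · exact ⟨0, 0, le_rfl, hl.le, by simp [bumpInt, he], by simp [bump_edgePoint_inner, he]⟩
  obtain ⟨s, c, h0, h1, hbi, hb⟩ := hb
  rw [(hG.edgeDensity_eq hΓ e).1, hbi, res]
  set L := Γ.len e with hL
  set A := Γ.interp (G (Γ.src e)) x
  set B := Γ.interp (G (Γ.tgt e)) x
  set a := G (Γ.src e) (Γ.src e)
  set b := G (Γ.tgt e) (Γ.tgt e)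
  set m := G (Γ.src e) (Γ.tgt e) with hm
  set k := Γ.green G x x
  have hcongr : ∫ t in (0 : ℝ)..L, Γ.resistance x (Γ.edgePoint e t) =
      ∫ t in (0 : ℝ)..L, ((k + a - 2 * A) +
        ((2 * m - 2 * a) / L + 1 - 2 * (B - A) / L + 2 * c * s / L) * t
        + ((a + b - 2 * m) / L ^ 2 - 1 / L) * t ^ 2 + (-2 * c) * min t s) := by
    refine intervalIntegral.integral_congr fun t ht => ?_
    rw [uIcc_of_le hl.le] at ht
    have hgx : Γ.green G (Γ.edgePoint e t) x =
        A + t / L * (B - A) + c * (min t s - t * s / L) := by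
      rw [green, interp_edgePoint, hb, clamp_of_mem _ ht.1 ht.2]
    rw [hG.resistance_eq hΓ, green_comm hG.symm x (Γ.edgePoint e t), hgx, green_edgePoint_self,
      clamp_of_mem _ ht.1 ht.2, hG.symm (Γ.tgt e) (Γ.src e), ← hL]
    field_simp
    ring
  rw [hcongr, integral_quadratic_add_min h0 h1]
  field_simp
  ring

/-- Total mass 1: an edge has mass 1 - r_e/L_e, so Foster's theorem gives #E - #V + 1 on the edges,
and the vertices contribute #V - #E. -/
theorem sum_canon (hG : Γ.IsGreen G) (hΓ : Γ.Connected) :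
    ∑ p, (1 - (Γ.valence p : ℝ) / 2) + ∑ e, Γ.edgeDensity e * Γ.len e = 1 := by
  have h1 := hG.sum_res_div_len hΓ.1
  have h2 := Γ.sum_valence_mul (fun _ => 1)
  have h3 : ∀ e, Γ.edgeDensity e * Γ.len e = 1 - res G (Γ.src e) (Γ.tgt e) / Γ.len e := by
    intro e
    have := (Γ.len_pos e).ne'
    rw [(hG.edgeDensity_eq hΓ e).1]
    field_simp
  simp only [mul_one, Finset.sum_const, Finset.card_univ, nsmul_eq_mul] at h2
  simp only [h3, Finset.sum_sub_distrib, h1, ← Finset.sum_div, h2, Finset.sum_const,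
    Finset.card_univ, nsmul_eq_mul, mul_one]
  ring

theorem canonInt_resistance (hG : Γ.IsGreen G) (hΓ : Γ.Connected) (x : Γ.Point) :
    Γ.canonInt (Γ.resistance x) =
      (Γ.green G x x - 2 * ∑ q, Γ.interp (G q) x
        + ∑ e, res G (Γ.src e) (Γ.tgt e) / Γ.len e *
          (Γ.interp (G (Γ.src e)) x + Γ.interp (G (Γ.tgt e)) x)
        - 2 * ∑ e, Γ.edgeDensity e * Γ.bumpInt x e)
      + (∑ q, G q q - (∑ e, res G (Γ.src e) (Γ.tgt e) / Γ.len e *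
          (G (Γ.src e) (Γ.src e) + G (Γ.tgt e) (Γ.tgt e))) / 2
        + ∑ e, Γ.edgeDensity e ^ 2 * Γ.len e ^ 3 / 6) := by
  have hD : ∀ e, Γ.edgeDensity e * Γ.len e = 1 - res G (Γ.src e) (Γ.tgt e) / Γ.len e := by
    intro e
    have := (Γ.len_pos e).ne'
    rw [(hG.edgeDensity_eq hΓ e).1]
    field_simp
  have hr : ∀ q, Γ.resistance x (.vertex q) = Γ.green G x x + G q q - 2 * Γ.interp (G q) x := by
    intro q
    rw [hG.resistance_eq hΓ, green_comm hG.symm x (.vertex q), green_vertex_left, green_vertex_left]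
    rfl
  have hsum := hG.sum_canon hΓ
  have hv1 := Γ.sum_valence_mul (fun q => G q q)
  have hv2 := Γ.sum_valence_mul (fun q => Γ.interp (G q) x)
  have h1 : ∑ p, (1 - (Γ.valence p : ℝ) / 2) * Γ.resistance x (.vertex p) =
      (∑ p, (1 - (Γ.valence p : ℝ) / 2)) * Γ.green G x x +
      (∑ q, G q q - (∑ p, (Γ.valence p : ℝ) * G p p) / 2) -
      2 * (∑ q, Γ.interp (G q) x - (∑ p, (Γ.valence p : ℝ) * Γ.interp (G p) x) / 2) := by
    simp only [hr, Finset.sum_mul, Finset.mul_sum, Finset.sum_div, ← Finset.sum_sub_distrib,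
      ← Finset.sum_add_distrib]
    exact Finset.sum_congr rfl fun p _ => by ring
  have h2 : ∑ e, Γ.edgeDensity e *
      ∫ t in (0 : ℝ)..Γ.len e, Γ.resistance x (Γ.edgePoint e t) =
      (∑ e, Γ.edgeDensity e * Γ.len e) * Γ.green G x x +
      (∑ e, (G (Γ.src e) (Γ.src e) + G (Γ.tgt e) (Γ.tgt e))) / 2
      - (∑ e, res G (Γ.src e) (Γ.tgt e) / Γ.len e *
          (G (Γ.src e) (Γ.src e) + G (Γ.tgt e) (Γ.tgt e))) / 2
      - ∑ e, (Γ.interp (G (Γ.src e)) x + Γ.interp (G (Γ.tgt e)) x)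
      + ∑ e, res G (Γ.src e) (Γ.tgt e) / Γ.len e *
          (Γ.interp (G (Γ.src e)) x + Γ.interp (G (Γ.tgt e)) x)
      + ∑ e, Γ.edgeDensity e ^ 2 * Γ.len e ^ 3 / 6
      - 2 * ∑ e, Γ.edgeDensity e * Γ.bumpInt x e := by
    simp only [hG.integral_edge_resistance hΓ, Finset.sum_mul, Finset.mul_sum, Finset.sum_div,
      ← Finset.sum_sub_distrib, ← Finset.sum_add_distrib]
    refine Finset.sum_congr rfl fun e _ => ?_
    linear_combination ((G (Γ.src e) (Γ.src e) + G (Γ.tgt e) (Γ.tgt e)) / 2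
        - (Γ.interp (G (Γ.src e)) x + Γ.interp (G (Γ.tgt e)) x)) * hD e
  rw [canonInt, h1, h2, hv1, hv2]
  linear_combination Γ.green G x x * hsum

/-- The canonical integral of `r(x, ·)` does not depend on `x`. -/
theorem canonInt_resistance_eq (hG : Γ.IsGreen G) (hΓ : Γ.Connected) (x y : Γ.Point) :
    Γ.canonInt (Γ.resistance x) = Γ.canonInt (Γ.resistance y) := by
  have hv : ∀ p q : V, Γ.canonInt (Γ.resistance (.vertex p)) =
      Γ.canonInt (Γ.resistance (.vertex q)) := by
    intro p q
    have h1 := hG.diag_add_sum hΓ.1 p q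
    have h2 := hG.sum_eq hΓ.1 p q
    rw [hG.canonInt_resistance hΓ, hG.canonInt_resistance hΓ]
    simp only [green_vertex_left, interp, bumpInt, mul_zero, Finset.sum_const_zero,
      hG.symm _ p, hG.symm _ q]
    linarith
  obtain ⟨p⟩ := hΓ.1
  suffices h : ∀ x, Γ.canonInt (Γ.resistance x) = Γ.canonInt (Γ.resistance (.vertex p)) by
    rw [h x, h y]
  clear x y
  intro x
  cases x with
  | vertex q => exact hv q p
  | inner e s h0 h1 =>
    have ha := hv (Γ.src e) p
    have hb := hv (Γ.tgt e) p
    rw [hG.canonInt_resistance hΓ (.vertex (Γ.src e))] at ha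
    rw [hG.canonInt_resistance hΓ (.vertex (Γ.tgt e))] at hb
    rw [hG.canonInt_resistance hΓ]
    have hbump : ∑ e', Γ.edgeDensity e' * Γ.bumpInt (.inner e s h0 h1) e' =
        Γ.edgeDensity e * (s * (Γ.len e - s) / 2) := by
      simp [bumpInt]
    have hbv : ∀ q, ∑ e', Γ.edgeDensity e' * Γ.bumpInt (.vertex q) e' = 0 := by
      simp [bumpInt]
    have hlin : ∀ f : V → ℝ, Γ.interp f (.inner e s h0 h1) =
        (1 - s / Γ.len e) * Γ.interp f (.vertex (Γ.src e)) +
          s / Γ.len e * Γ.interp f (.vertex (Γ.tgt e)) := by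
      intro f; simp only [interp]; ring
    have hs1 : ∑ q, Γ.interp (G q) (.inner e s h0 h1) =
        (1 - s / Γ.len e) * ∑ q, Γ.interp (G q) (.vertex (Γ.src e)) +
          s / Γ.len e * ∑ q, Γ.interp (G q) (.vertex (Γ.tgt e)) := by
      simp only [hlin, Finset.mul_sum, ← Finset.sum_add_distrib]
    have hs2 : ∑ e', res G (Γ.src e') (Γ.tgt e') / Γ.len e' *
        (Γ.interp (G (Γ.src e')) (.inner e s h0 h1) +
          Γ.interp (G (Γ.tgt e')) (.inner e s h0 h1)) =
        (1 - s / Γ.len e) * ∑ e', res G (Γ.src e') (Γ.tgt e') / Γ.len e' *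
        (Γ.interp (G (Γ.src e')) (.vertex (Γ.src e)) +
          Γ.interp (G (Γ.tgt e')) (.vertex (Γ.src e))) +
        s / Γ.len e * ∑ e', res G (Γ.src e') (Γ.tgt e') / Γ.len e' *
        (Γ.interp (G (Γ.src e')) (.vertex (Γ.tgt e)) +
          Γ.interp (G (Γ.tgt e')) (.vertex (Γ.tgt e))) := by
      simp only [hlin _, Finset.mul_sum, ← Finset.sum_add_distrib]
      exact Finset.sum_congr rfl fun e' _ => by ring
    -- Along an edge all other terms are affine. The diagonal deviates from affine by D s(L - s),
    -- with D the edge density, and the `bumpInt` term removes exactly this amount.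
    have hdiag : Γ.green G (.inner e s h0 h1) (.inner e s h0 h1) =
        (1 - s / Γ.len e) * Γ.green G (.vertex (Γ.src e)) (.vertex (Γ.src e)) +
        s / Γ.len e * Γ.green G (.vertex (Γ.tgt e)) (.vertex (Γ.tgt e)) +
        Γ.edgeDensity e * (s * (Γ.len e - s)) := by
      have hl := (Γ.len_pos e).ne'
      have h := Γ.green_edgePoint_self G e s
      rw [edgePoint_inner _ h0 h1, clamp_of_mem _ h0.le h1.le] at h
      rw [h, (hG.edgeDensity_eq hΓ e).1]
      simp only [green_vertex_left, interp, res, hG.symm (Γ.tgt e) (Γ.src e)]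
      field_simp
      ring
    rw [hs1, hs2, hbump, hdiag]
    rw [hbv] at ha hb
    linear_combination (1 - s / Γ.len e) * ha + s / Γ.len e * hb

/-- The valence terms combine with the edge integrals into half the right side of `sum_sq_res`. In
this form T is a sum over the edges, ready for comparison with the total length. -/
theorem canonInt_resistance_vertex (hG : Γ.IsGreen G) (hΓ : Γ.Connected) (p : V) :
    Γ.canonInt (Γ.resistance (.vertex p)) = (∑ e, (res G p (Γ.src e) - res G p (Γ.tgt e)) ^ 2 /
      Γ.len e) / 2 + ∑ e, Γ.edgeDensity e ^ 2 * Γ.len e ^ 3 / 6 := by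
  have hD : ∀ e, Γ.edgeDensity e * Γ.len e = 1 - res G (Γ.src e) (Γ.tgt e) / Γ.len e := by
    intro e
    have := (Γ.len_pos e).ne'
    rw [(hG.edgeDensity_eq hΓ e).1]
    field_simp
  have hv := Γ.sum_valence_mul (res G p)
  have h1 : ∑ q, (1 - (Γ.valence q : ℝ) / 2) * Γ.resistance (.vertex p) (.vertex q) =
      ∑ q, res G p q - (∑ q, (Γ.valence q : ℝ) * res G p q) / 2 := by
    simp only [hG.resistance_vertex hΓ, Finset.sum_div, ← Finset.sum_sub_distrib]
    exact Finset.sum_congr rfl fun q _ => by ring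
  have h2 : ∑ e, Γ.edgeDensity e *
      ∫ t in (0 : ℝ)..Γ.len e, Γ.resistance (.vertex p) (Γ.edgePoint e t) =
      (∑ e, (res G p (Γ.src e) + res G p (Γ.tgt e))) / 2 -
      (∑ e, res G (Γ.src e) (Γ.tgt e) / Γ.len e * (res G p (Γ.src e) + res G p (Γ.tgt e))) / 2
      + ∑ e, Γ.edgeDensity e ^ 2 * Γ.len e ^ 3 / 6 := by
    simp only [hG.integral_edge_resistance hΓ, Finset.sum_div,
      ← Finset.sum_sub_distrib, ← Finset.sum_add_distrib]
    refine Finset.sum_congr rfl fun e _ => ?_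
    simp only [green_vertex_left, interp, bumpInt, hG.symm (Γ.src e) p, hG.symm (Γ.tgt e) p]
    have h3 : res G p (Γ.src e) + res G p (Γ.tgt e) = 2 * (G p p +
        (G (Γ.src e) (Γ.src e) + G (Γ.tgt e) (Γ.tgt e)) / 2
        - (G p (Γ.src e) + G p (Γ.tgt e))) := by
      simp only [res]; ring
    rw [h3]
    linear_combination (G p p + (G (Γ.src e) (Γ.src e) + G (Γ.tgt e) (Γ.tgt e)) / 2
        - (G p (Γ.src e) + G p (Γ.tgt e))) * hD e
  rw [canonInt, h1, h2, hv, hG.sum_sq_res]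
  ring

/-- The pointwise form of the main inequality. -/
theorem totalLength_le (hG : Γ.IsGreen G) (hΓ : Γ.Connected) (p : V) :
    Γ.totalLength ≤ 6 * Γ.canonInt (Γ.resistance (.vertex p)) +
      2 * ∑ q, ((Γ.valence q : ℝ) - 2) * res G p q := by
  have hv := Γ.sum_valence_mul (res G p)
  have h2 := hG.sum_sq_res p
  have h3 : ∑ q, ((Γ.valence q : ℝ) - 2) * res G p q =
      ∑ e, (res G p (Γ.src e) + res G p (Γ.tgt e)) - 2 * ∑ q, res G p q := by
    rw [← hv, Finset.mul_sum, ← Finset.sum_sub_distrib]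
    exact Finset.sum_congr rfl fun q _ => by ring
  have h4 : 6 * Γ.canonInt (Γ.resistance (.vertex p)) +
      2 * ∑ q, ((Γ.valence q : ℝ) - 2) * res G p q =
      ∑ e, ((res G p (Γ.src e) - res G p (Γ.tgt e)) ^ 2 / Γ.len e
        + Γ.edgeDensity e ^ 2 * Γ.len e ^ 3 + 2 * (res G p (Γ.src e) + res G p (Γ.tgt e))
        - 2 * (res G (Γ.src e) (Γ.tgt e) / Γ.len e *
          (res G p (Γ.src e) + res G p (Γ.tgt e)))) := by
    rw [hG.canonInt_resistance_vertex hΓ, h3]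
    simp only [Finset.sum_sub_distrib, Finset.sum_add_distrib, ← Finset.mul_sum, ← Finset.sum_div]
      at h2 ⊢
    linear_combination 2 * h2
  rw [h4, totalLength]
  refine Finset.sum_le_sum fun e _ => ?_
  have h5 := hG.len_minor_le hΓ p e
  -- With D the edge density, D² L³ = (L - r)²/L, so this is a polynomial identity once r is
  -- expressed through `G`.
  have h6 : (res G p (Γ.src e) - res G p (Γ.tgt e)) ^ 2 / Γ.len e
        + Γ.edgeDensity e ^ 2 * Γ.len e ^ 3 + 2 * (res G p (Γ.src e) + res G p (Γ.tgt e))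
        - 2 * (res G (Γ.src e) (Γ.tgt e) / Γ.len e *
          (res G p (Γ.src e) + res G p (Γ.tgt e))) - Γ.len e =
      4 * (pot G p (Γ.src e) (Γ.tgt e) -
        (pot G p (Γ.src e) (Γ.src e) * pot G p (Γ.tgt e) (Γ.tgt e)
          - pot G p (Γ.src e) (Γ.tgt e) ^ 2) / Γ.len e) := by
    have hl := (Γ.len_pos e).ne'
    rw [(hG.edgeDensity_eq hΓ e).1]
    simp only [pot, res, hG.symm (Γ.src e) p, hG.symm (Γ.tgt e) p]
    field_simp
    ring
  linarith

end IsGreen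

end LengthGraph

/-! ### Integration over the realization and the tau constant. -/

namespace LengthGraph

open scoped Classical

variable {V E : Type*} {Γ : LengthGraph V E}

instance (e : E) : IsFiniteMeasure (Γ.edgeMeasure e) := by
  unfold edgeMeasure; infer_instance

theorem edgeMeasure_univ (e : E) : (Γ.edgeMeasure e).real univ = Γ.len e := by
  rw [edgeMeasure, measureReal_def,
    Measure.map_apply (Γ.continuous_edgePoint e).measurable MeasurableSet.univ, preimage_univ,
    Measure.restrict_apply_univ, Real.volume_Icc, sub_zero, ENNReal.toReal_ofReal (Γ.len_pos e).le]

theorem integrable_edgeMeasure (e : E) {f : Γ.Point → ℝ} (hf : Continuous f) :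
    Integrable f (Γ.edgeMeasure e) := by
  rw [edgeMeasure, integrable_map_measure hf.aestronglyMeasurable
    (Γ.continuous_edgePoint e).aemeasurable]
  exact (hf.comp (Γ.continuous_edgePoint e)).continuousOn.integrableOn_Icc

theorem integral_edgeMeasure (e : E) {f : Γ.Point → ℝ} (hf : Continuous f) :
    ∫ x, f x ∂Γ.edgeMeasure e = ∫ t in (0 : ℝ)..Γ.len e, f (Γ.edgePoint e t) := by
  rw [edgeMeasure, integral_map (Γ.continuous_edgePoint e).aemeasurable hf.aestronglyMeasurable,
    intervalIntegral.integral_of_le (Γ.len_pos e).le, integral_Icc_eq_integral_Ioc]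

theorem integrable_dirac_vertex (p : V) {f : Γ.Point → ℝ} (hf : Continuous f) :
    Integrable f (Measure.dirac (.vertex p : Γ.Point)) :=
  integrable_dirac' hf.stronglyMeasurable (by simp)

theorem abs_interp_le [Fintype V] (f : V → ℝ) (x : Γ.Point) : |Γ.interp f x| ≤ ∑ p, |f p| := by
  have h : ∀ p, |f p| ≤ ∑ p, |f p| := fun p =>
    Finset.single_le_sum (fun q _ => abs_nonneg (f q)) (Finset.mem_univ p)
  cases x with
  | vertex p => exact h p
  | inner e t h0 h1 =>
    have hl := Γ.len_pos e
    have hu0 : 0 ≤ t / Γ.len e := by positivity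
    have hu1 : t / Γ.len e ≤ 1 := by rw [div_le_one hl]; exact h1.le
    have ha := abs_le.1 (h (Γ.src e))
    have hb := abs_le.1 (h (Γ.tgt e))
    simp only [interp]
    rw [show f (Γ.src e) + t / Γ.len e * (f (Γ.tgt e) - f (Γ.src e)) =
      (1 - t / Γ.len e) * f (Γ.src e) + t / Γ.len e * f (Γ.tgt e) by ring]
    rw [abs_le]
    constructor <;> nlinarith

variable [Fintype E]

theorem abs_bump_le (x y : Γ.Point) : |Γ.bump x y| ≤ ∑ e, Γ.len e := by
  have hs : 0 ≤ ∑ e, Γ.len e := Finset.sum_nonneg fun e _ => (Γ.len_pos e).le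
  cases x with
  | vertex p => simpa using hs
  | inner e t h0 h1 =>
    cases y with
    | vertex p => simpa using hs
    | inner e' s h2 h3 =>
      simp only [bump]
      split_ifs with he
      · subst he
        have hl := Γ.len_pos e
        have h4 : Γ.len e ≤ ∑ e, Γ.len e :=
          Finset.single_le_sum (fun e _ => (Γ.len_pos e).le) (Finset.mem_univ e)
        have h5 : 0 ≤ t * s / Γ.len e := by positivity
        have h6 : t * s / Γ.len e ≤ min t s := by
          rw [div_le_iff₀ hl]
          rcases min_cases t s with ⟨h, _⟩ | ⟨h, _⟩ <;> rw [h] <;> nlinarith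
        have h7 : min t s ≤ t := min_le_left t s
        rw [abs_of_nonneg] <;> linarith
      · simpa using hs

variable [Fintype V]

theorem exists_green_bound (G : V → V → ℝ) : ∃ C, ∀ x y : Γ.Point, |Γ.green G x y| ≤ C := by
  refine ⟨∑ p, ∑ q, |G p q| + ∑ e, Γ.len e, fun x y => (abs_add_le _ _).trans
    (add_le_add ((abs_interp_le _ x).trans (Finset.sum_le_sum fun p _ => abs_interp_le _ y))
      (abs_bump_le x y))⟩

namespace IsGreen

variable {G : V → V → ℝ}

theorem exists_resistance_bound (hG : Γ.IsGreen G) (hΓ : Γ.Connected) :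
    ∃ C, ∀ x y : Γ.Point, ‖Γ.resistance x y‖ ≤ C := by
  obtain ⟨C, hC⟩ := exists_green_bound (Γ := Γ) G
  refine ⟨4 * C, fun x y => ?_⟩
  rw [hG.resistance_eq hΓ, Real.norm_eq_abs, abs_le]
  have h1 := abs_le.1 (hC x x)
  have h2 := abs_le.1 (hC y y)
  have h3 := abs_le.1 (hC x y)
  constructor <;> linarith

theorem continuous_resistance_left (hG : Γ.IsGreen G) (hΓ : Γ.Connected) (y : Γ.Point) :
    Continuous fun x => Γ.resistance x y := by
  simp only [fun x => hG.resistance_comm hΓ x y]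
  exact hG.continuous_resistance hΓ y

theorem integrable_resistance (hG : Γ.IsGreen G) (hΓ : Γ.Connected) (P : Measure Γ.Point)
    [IsFiniteMeasure P] (x : Γ.Point) : Integrable (Γ.resistance x) P := by
  obtain ⟨C, hC⟩ := hG.exists_resistance_bound hΓ
  exact Integrable.of_bound (hG.continuous_resistance hΓ x).aestronglyMeasurable C
    (Filter.Eventually.of_forall fun y => hC x y)

/-- For Fubini. Joint measurability comes from continuity in the real parameter for each fixed `y`
and measurability in `y`; integrability then follows from boundedness. -/
theorem integrable_edge_prod (hG : Γ.IsGreen G) (hΓ : Γ.Connected) (P : Measure Γ.Point)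
    [IsFiniteMeasure P] (e : E) :
    Integrable (Function.uncurry fun t y => Γ.resistance (Γ.edgePoint e t) y)
      ((volume.restrict (Ioc 0 (Γ.len e))).prod P) := by
  obtain ⟨C, hC⟩ := hG.exists_resistance_bound hΓ
  have h : StronglyMeasurable
      (Function.uncurry fun y t => Γ.resistance (Γ.edgePoint e t) y) := by
    have := stronglyMeasurable_uncurry_of_continuous_of_stronglyMeasurable
      (u := fun t y => Γ.resistance (Γ.edgePoint e t) y)
      (fun y => (hG.continuous_resistance_left hΓ y).comp (Γ.continuous_edgePoint e))
      (fun t => (hG.continuous_resistance hΓ (Γ.edgePoint e t)).stronglyMeasurable)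
    exact this.comp_measurable measurable_swap
  exact Integrable.of_bound (h.comp_measurable measurable_swap).aestronglyMeasurable C
    (Filter.Eventually.of_forall fun y => hC _ _)

/-- After exchanging the integrals, the inner canonical integral is the same constant for every `y`.
-/
theorem canonInt_integral (hG : Γ.IsGreen G) (hΓ : Γ.Connected) (P : Measure Γ.Point)
    [IsFiniteMeasure P] (z : Γ.Point) :
    Γ.canonInt (fun x => ∫ y, Γ.resistance x y ∂P) =
      P.real univ * Γ.canonInt (Γ.resistance z) := by
  have hconst : ∀ y, ∑ p, (1 - (Γ.valence p : ℝ) / 2) * Γ.resistance (.vertex p) y +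
      ∑ e, Γ.edgeDensity e * ∫ t in (0 : ℝ)..Γ.len e, Γ.resistance (Γ.edgePoint e t) y =
      Γ.canonInt (Γ.resistance z) := by
    intro y
    rw [hG.canonInt_resistance_eq hΓ z y, canonInt]
    simp only [fun x => hG.resistance_comm hΓ x y]
  have hswap : ∀ e, ∫ t in (0 : ℝ)..Γ.len e, ∫ y, Γ.resistance (Γ.edgePoint e t) y ∂P =
      ∫ y, (∫ t in (0 : ℝ)..Γ.len e, Γ.resistance (Γ.edgePoint e t) y) ∂P := by
    intro e
    simp only [intervalIntegral.integral_of_le (Γ.len_pos e).le]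
    exact integral_integral_swap (hG.integrable_edge_prod hΓ P e)
  have hi1 : ∀ p ∈ Finset.univ, Integrable
      (fun y => (1 - (Γ.valence p : ℝ) / 2) * Γ.resistance (.vertex p) y) P := fun p _ =>
    (hG.integrable_resistance hΓ P _).const_mul _
  have hi2 : ∀ e ∈ Finset.univ, Integrable (fun y => Γ.edgeDensity e *
      ∫ t in (0 : ℝ)..Γ.len e, Γ.resistance (Γ.edgePoint e t) y) P := by
    intro e _
    simp only [intervalIntegral.integral_of_le (Γ.len_pos e).le]
    exact (hG.integrable_edge_prod hΓ P e).integral_prod_right.const_mul _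
  have h := integral_congr_ae (μ := P) (Filter.Eventually.of_forall hconst)
  rw [integral_const, smul_eq_mul, integral_add (integrable_finsetSum _ hi1)
    (integrable_finsetSum _ hi2), integral_finsetSum _ hi1, integral_finsetSum _ hi2] at h
  simp only [integral_const_mul] at h
  rw [← h, canonInt]
  simp only [hswap]

/-- The double integral of r against μ and the canonical measure is 2t in one order and T in the
other, since both measures have mass 1. The Jordan parts of μ are treated separately. -/
theorem tau_unique (hG : Γ.IsGreen G) (hΓ : Γ.Connected) {t : ℝ} (ht : Γ.IsTauConstant t)
    (z : Γ.Point) : t = (1 / 2) * Γ.canonInt (Γ.resistance z) := by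
  obtain ⟨μ, hμ, h⟩ := ht
  set P := μ.toJordanDecomposition.posPart with hP
  set N := μ.toJordanDecomposition.negPart with hN
  have hdec : μ = P.toSignedMeasure - N.toSignedMeasure :=
    μ.toSignedMeasure_toJordanDecomposition.symm
  have hint : ∀ x, Γ.voltageIntegral μ x x =
      ∫ y, Γ.resistance x y ∂P - ∫ y, Γ.resistance x y ∂N := by
    intro x
    -- By definition j_ζ(x, x) = r(x, ζ).
    change (VectorMeasure.integral μ (Γ.resistance x) _) = _
    rw [hdec, VectorMeasure.integral_sub_vectorMeasure]
    · simp
    · simpa [VectorMeasure.Integrable] using hG.integrable_resistance hΓ P x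
    · simpa [VectorMeasure.Integrable] using hG.integrable_resistance hΓ N x
  have hconst : ∀ x, ∫ y, Γ.resistance x y ∂P = 2 * t + ∫ y, Γ.resistance x y ∂N := by
    intro x
    have := h x
    rw [hint] at this
    linarith
  have hPi := hG.canonInt_integral hΓ P z
  have hNi := hG.canonInt_integral hΓ N z
  have hadd : Γ.canonInt (fun x => 2 * t + ∫ y, Γ.resistance x y ∂N) =
      2 * t + Γ.canonInt (fun x => ∫ y, Γ.resistance x y ∂N) := by
    have h1 : ∀ e, ∫ s in (0 : ℝ)..Γ.len e, (2 * t + ∫ y, Γ.resistance (Γ.edgePoint e s) y ∂N) =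
        Γ.len e * (2 * t) +
          ∫ s in (0 : ℝ)..Γ.len e, ∫ y, Γ.resistance (Γ.edgePoint e s) y ∂N := by
      intro e
      rw [intervalIntegral.integral_add intervalIntegrable_const, intervalIntegral.integral_const,
        sub_zero, smul_eq_mul]
      rw [intervalIntegrable_iff_integrableOn_Ioc_of_le (Γ.len_pos e).le]
      exact (hG.integrable_edge_prod hΓ N e).integral_prod_left
    have h2 := hG.sum_canon hΓ
    simp only [canonInt, h1, mul_add, Finset.sum_add_distrib, ← Finset.sum_mul, ← mul_assoc]
    linear_combination (2 * t) * h2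
  simp only [hconst] at hPi
  rw [hadd, hNi] at hPi
  have hmass : P.real univ - N.real univ = 1 := by
    rw [← hμ, hdec]
    simp
  linear_combination (1 / 2) * hPi + (1 / 2) * Γ.canonInt (Γ.resistance z) * hmass

/-- The canonical measure, as a signed measure. -/
def _root_.LengthGraph.canonSigned (Γ : LengthGraph V E) : SignedMeasure Γ.Point :=
  ∑ p, (1 - (Γ.valence p : ℝ) / 2) • (Measure.dirac (.vertex p : Γ.Point)).toSignedMeasure +
    ∑ e, Γ.edgeDensity e • (Γ.edgeMeasure e).toSignedMeasure

theorem isTauConstant (hG : Γ.IsGreen G) (hΓ : Γ.Connected) (z : Γ.Point) :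
    Γ.IsTauConstant ((1 / 2) * Γ.canonInt (Γ.resistance z)) := by
  refine ⟨Γ.canonSigned, ?_, fun x => ?_⟩
  · rw [← hG.sum_canon hΓ, canonSigned]
    simp [edgeMeasure_univ]
  · rw [hG.canonInt_resistance_eq hΓ z x]
    congr 1
    change VectorMeasure.integral _ (Γ.resistance x) _ = _
    have hc := hG.continuous_resistance hΓ x
    have hi1 : ∀ p ∈ Finset.univ, ((1 - (Γ.valence p : ℝ) / 2) •
        (Measure.dirac (.vertex p : Γ.Point)).toSignedMeasure).Integrable (Γ.resistance x) :=
      fun p _ => VectorMeasure.Integrable.smul_vectorMeasure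
        (by simpa [VectorMeasure.Integrable] using integrable_dirac_vertex p hc) _
    have hi2 : ∀ e ∈ Finset.univ, (Γ.edgeDensity e •
        (Γ.edgeMeasure e).toSignedMeasure).Integrable (Γ.resistance x) :=
      fun e _ => VectorMeasure.Integrable.smul_vectorMeasure
        (by simpa [VectorMeasure.Integrable] using integrable_edgeMeasure e hc) _
    rw [canonSigned, VectorMeasure.integral_add_vectorMeasure
      (VectorMeasure.Integrable.finsetSum_vectorMeasure hi1)
      (VectorMeasure.Integrable.finsetSum_vectorMeasure hi2),
      VectorMeasure.integral_finsetSum_vectorMeasure hi1,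
      VectorMeasure.integral_finsetSum_vectorMeasure hi2, canonInt]
    simp only [VectorMeasure.integral_smul_vectorMeasure, VectorMeasure.integral_toSignedMeasure,
      smul_eq_mul]
    congr 1
    · refine Finset.sum_congr rfl fun p _ => ?_
      rw [integral_dirac' _ _ hc.stronglyMeasurable]
    · refine Finset.sum_congr rfl fun e _ => ?_
      rw [integral_edgeMeasure e hc]

theorem tau_eq (hG : Γ.IsGreen G) (hΓ : Γ.Connected) (z : Γ.Point) :
    Γ.tau = (1 / 2) * Γ.canonInt (Γ.resistance z) := by
  have h : ∃ t, Γ.IsTauConstant t := ⟨_, hG.isTauConstant hΓ z⟩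
  rw [tau, dif_pos h]
  exact hG.tau_unique hΓ h.choose_spec z

end IsGreen

end LengthGraph

/-! ### The invariants of a pm-graph in terms of θ and the canonical integral. -/

namespace PMGraph

open LengthGraph

variable {V E : Type*} [Fintype V] [Fintype E] (Γ : PMGraph V E)

theorem sum_canon : ∑ p, (Γ.canon p : ℝ) = 2 * ((Γ.pmGenus : ℝ) - 1) := by
  have h := Γ.sum_valence_mul (fun _ => 1)
  simp only [mul_one, Finset.sum_const, Finset.card_univ, nsmul_eq_mul] at h
  simp only [canon, pmGenus, genus]
  push_cast
  simp only [Finset.sum_add_distrib, Finset.sum_sub_distrib, h, ← Finset.mul_sum,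
    Finset.sum_const, Finset.card_univ, nsmul_eq_mul]
  ring

theorem canon_nonneg (p : V) : (0 : ℝ) ≤ Γ.canon p := by
  exact_mod_cast Γ.effective p

theorem one_le_pmGenus : (1 : ℝ) ≤ Γ.pmGenus := by
  have h1 := Γ.sum_canon
  have h2 : 0 ≤ ∑ p, (Γ.canon p : ℝ) := Finset.sum_nonneg fun p _ => Γ.canon_nonneg p
  linarith

theorem integral_canonMeasure {f : Γ.Point → ℝ} (hf : Continuous f) :
    ∫ x, f x ∂Γ.canonMeasure = ∑ p, (Γ.canon p : ℝ) * f (.vertex p) := by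
  simp only [canonMeasure, ← Nat.cast_smul_eq_nsmul ENNReal]
  rw [integral_finsetSum_measure fun p _ =>
    (integrable_dirac_vertex p hf).smul_measure (ENNReal.natCast_ne_top _)]
  refine Finset.sum_congr rfl fun p _ => ?_
  have h : (((Γ.canon p).toNat : ℤ) : ℝ) = Γ.canon p := by
    rw [Int.toNat_of_nonneg (show 0 ≤ Γ.canon p from Γ.effective p)]
  rw [integral_smul_measure, integral_dirac' _ _ hf.stronglyMeasurable, smul_eq_mul,
    ENNReal.toReal_natCast, ← h, Int.cast_natCast]

instance : IsFiniteMeasure Γ.admissibleMeasure := by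
  unfold admissibleMeasure
  have h1 : IsFiniteMeasure (∑ p, Γ.q p • Measure.dirac (.vertex p : Γ.Point)) := by
    simp only [← Nat.cast_smul_eq_nsmul ENNReal]
    exact ⟨by simp [ENNReal.sum_lt_top]⟩
  have h2 : IsFiniteMeasure (∑ e, ENNReal.ofReal (Γ.edgeDensity e) • Γ.edgeMeasure e) :=
    ⟨by simp [ENNReal.sum_lt_top, ENNReal.mul_lt_top]⟩
  -- `ENNReal.ofReal` is the coercion of `Real.toNNReal`, and scaling by a non-negative real
  -- preserves finiteness.
  exact (inferInstance : IsFiniteMeasure (Real.toNNReal (1 / (Γ.pmGenus : ℝ)) •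
    ((∑ p, Γ.q p • Measure.dirac (.vertex p : Γ.Point)) +
      ∑ e, ENNReal.ofReal (Γ.edgeDensity e) • Γ.edgeMeasure e)))

/-- Since q(p) = k_p/2 + (1 - v(p)/2), the admissible measure is (δ_K/2 + μ_can)/ḡ. -/
theorem integral_admissibleMeasure {f : Γ.Point → ℝ} (hf : Continuous f) :
    ∫ x, f x ∂Γ.admissibleMeasure = 1 / (Γ.pmGenus : ℝ) *
      ((∑ p, (Γ.canon p : ℝ) * f (.vertex p)) / 2 + Γ.canonInt f) := by
  obtain ⟨G, hG⟩ := Γ.exists_isGreen Γ.connected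
  have hg := Γ.one_le_pmGenus
  have hi1 : ∀ p ∈ Finset.univ, Integrable f
      ((Γ.q p : ENNReal) • Measure.dirac (.vertex p : Γ.Point)) := fun p _ =>
    (integrable_dirac_vertex p hf).smul_measure (ENNReal.natCast_ne_top _)
  have hi2 : ∀ e ∈ Finset.univ, Integrable f
      (ENNReal.ofReal (Γ.edgeDensity e) • Γ.edgeMeasure e) := fun e _ =>
    (integrable_edgeMeasure e hf).smul_measure ENNReal.ofReal_ne_top
  simp only [admissibleMeasure, ← Nat.cast_smul_eq_nsmul ENNReal]
  rw [integral_smul_measure, ENNReal.toReal_ofReal (by positivity), smul_eq_mul,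
    integral_add_measure (integrable_finsetSum_measure.2 hi1)
      (integrable_finsetSum_measure.2 hi2),
    integral_finsetSum_measure hi1, integral_finsetSum_measure hi2, canonInt, ← add_assoc,
    Finset.sum_div, ← Finset.sum_add_distrib]
  congr 2
  · refine Finset.sum_congr rfl fun p _ => ?_
    rw [integral_smul_measure, integral_dirac' _ _ hf.stronglyMeasurable, smul_eq_mul,
      ENNReal.toReal_natCast, canon]
    push_cast
    ring
  · refine Finset.sum_congr rfl fun e _ => ?_
    rw [integral_smul_measure, integral_edgeMeasure e hf, smul_eq_mul,
      ENNReal.toReal_ofReal (hG.edgeDensity_eq Γ.connected e).2]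

variable {Γ} {G : V → V → ℝ}

theorem integral_resistance_admissibleMeasure (hG : Γ.IsGreen G) (x z : Γ.Point) :
    ∫ y, Γ.resistance x y ∂Γ.admissibleMeasure = 1 / (Γ.pmGenus : ℝ) *
      ((∑ p, (Γ.canon p : ℝ) * Γ.resistance x (.vertex p)) / 2 +
        Γ.canonInt (Γ.resistance z)) := by
  rw [Γ.integral_admissibleMeasure (hG.continuous_resistance Γ.connected x),
    hG.canonInt_resistance_eq Γ.connected x z]

theorem admissibleMeasure_univ (hG : Γ.IsGreen G) : Γ.admissibleMeasure.real univ = 1 := by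
  have h := Γ.integral_admissibleMeasure (f := fun _ => 1) continuous_const
  have h2 := hG.sum_canon Γ.connected
  have h3 : Γ.canonInt (fun _ => 1) = 1 := by
    simp only [canonInt, mul_one, intervalIntegral.integral_const, sub_zero, smul_eq_mul]
    exact h2
  have hg : (Γ.pmGenus : ℝ) ≠ 0 := (zero_lt_one.trans_le Γ.one_le_pmGenus).ne'
  simp only [mul_one, Γ.sum_canon, h3, integral_const, smul_eq_mul] at h
  rw [h]
  field_simp
  ring

theorem epsilon_eq (hG : Γ.IsGreen G) (z : Γ.Point) :
    Γ.epsilon = 1 / (Γ.pmGenus : ℝ) *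
      (Γ.theta / 2 + 2 * ((Γ.pmGenus : ℝ) - 1) * Γ.canonInt (Γ.resistance z)) := by
  have hc := Γ.connected
  have hi : ∀ p ∈ Finset.univ, Integrable
      (fun y => (Γ.canon p : ℝ) * Γ.resistance (.vertex p) y) Γ.admissibleMeasure := fun p _ =>
    (hG.integrable_resistance hc _ _).const_mul _
  simp only [epsilon, Γ.integral_canonMeasure (hG.continuous_resistance_left hc _)]
  rw [integral_finsetSum _ hi]
  simp only [integral_const_mul, integral_resistance_admissibleMeasure hG _ z]
  rw [← Γ.sum_canon, theta, Finset.sum_mul, Finset.sum_div, ← Finset.sum_add_distrib,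
    Finset.mul_sum]
  refine Finset.sum_congr rfl fun p _ => ?_
  simp only [mul_assoc, ← Finset.mul_sum]
  ring

/-- Integrating r once against the admissible measure leaves half the δ_K-integral plus the constant
T. The second integration turns the former into ε/2 and keeps T, the total mass being 1. -/
theorem aInv_eq (hG : Γ.IsGreen G) (z : Γ.Point) :
    Γ.aInv = 1 / (2 * (Γ.pmGenus : ℝ)) *
      (Γ.epsilon / 2 + Γ.canonInt (Γ.resistance z)) := by
  have hc := Γ.connected
  have hi : ∀ p ∈ Finset.univ, Integrable
      (fun y => (Γ.canon p : ℝ) * Γ.resistance (.vertex p) y) Γ.admissibleMeasure := fun p _ =>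
    (hG.integrable_resistance hc _ _).const_mul _
  have hin : ∀ y, ∫ x, Γ.resistance x y ∂Γ.admissibleMeasure = 1 / (Γ.pmGenus : ℝ) *
      ((∑ p, (Γ.canon p : ℝ) * Γ.resistance (.vertex p) y) / 2 +
        Γ.canonInt (Γ.resistance z)) := by
    intro y
    simp only [fun x => hG.resistance_comm hc x y]
    rw [integral_resistance_admissibleMeasure hG y z]
  have heps : Γ.epsilon = ∫ y, ∑ p, (Γ.canon p : ℝ) * Γ.resistance (.vertex p) y
      ∂Γ.admissibleMeasure := by
    simp only [epsilon, Γ.integral_canonMeasure (hG.continuous_resistance_left hc _)]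
  simp only [aInv, hin]
  rw [integral_const_mul, integral_add ((integrable_finsetSum _ hi).div_const 2)
    (integrable_const _), integral_div, ← heps, integral_const, admissibleMeasure_univ hG,
    one_smul]
  ring

/-- The average of the pointwise bound with weights k_p ≥ 0 of total 2(ḡ - 1). Replacing v(q) - 2 by
k_q is allowed because q(q) ≥ 0 and r ≥ 0. -/
theorem totalLength_mul_le (hG : Γ.IsGreen G) (z : Γ.Point) :
    ((Γ.pmGenus : ℝ) - 1) * Γ.totalLength ≤
      6 * ((Γ.pmGenus : ℝ) - 1) * Γ.canonInt (Γ.resistance z) + Γ.theta := by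
  have hc := Γ.connected
  have h : ∀ p, (Γ.canon p : ℝ) * Γ.totalLength ≤ (Γ.canon p : ℝ) *
      (6 * Γ.canonInt (Γ.resistance z)) +
      2 * ∑ q, (Γ.canon p : ℝ) * (Γ.canon q : ℝ) * Γ.resistance (.vertex p) (.vertex q) := by
    intro p
    have h1 := hG.totalLength_le hc p
    rw [hG.canonInt_resistance_eq hc (.vertex p) z] at h1
    have h2 : ∑ q, ((Γ.valence q : ℝ) - 2) * res G p q ≤
        ∑ q, (Γ.canon q : ℝ) * Γ.resistance (.vertex p) (.vertex q) := by
      refine Finset.sum_le_sum fun q _ => ?_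
      rw [hG.resistance_vertex hc]
      refine mul_le_mul_of_nonneg_right ?_ (hG.res_nonneg p q)
      rw [canon]
      push_cast
      have : (0 : ℝ) ≤ Γ.q q := Nat.cast_nonneg _
      linarith
    have h3 := mul_le_mul_of_nonneg_left (h1.trans (add_le_add_right
      (mul_le_mul_of_nonneg_left h2 zero_le_two) _)) (Γ.canon_nonneg p)
    simp only [mul_assoc, ← Finset.mul_sum]
    linarith
  have h4 := Finset.sum_le_sum fun p (_ : p ∈ Finset.univ) => h p
  rw [← Finset.sum_mul, Finset.sum_add_distrib, ← Finset.sum_mul, ← Finset.mul_sum,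
    Γ.sum_canon] at h4
  change _ ≤ _ + 2 * Γ.theta at h4
  linarith

/-- The lower bound for `ε` is equivalent to an upper bound for the total length. -/
theorem le_epsilon_iff (Γ : PMGraph V E) :
    ((Γ.pmGenus : ℝ) - 1) / ((Γ.pmGenus : ℝ) + 1)
        * (Γ.totalLength - 4 * (Γ.pmGenus : ℝ) * Γ.aInv) ≤ Γ.epsilon ↔
      ((Γ.pmGenus : ℝ) - 1) * Γ.totalLength ≤
        12 * ((Γ.pmGenus : ℝ) - 1) * Γ.tau + Γ.theta := by
  obtain ⟨G, hG⟩ := Γ.exists_isGreen Γ.connected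
  obtain ⟨p⟩ := Γ.connected.1
  have hg := Γ.one_le_pmGenus
  rw [aInv_eq hG (.vertex p), hG.tau_eq Γ.connected (.vertex p)]
  have he := epsilon_eq hG (.vertex p)
  set g := (Γ.pmGenus : ℝ)
  set T := Γ.canonInt (Γ.resistance (.vertex p))
  have hg0 : g ≠ 0 := by positivity
  -- With 4ḡ a = ε + 2T, the bound reads (ḡ - 1)(ℓ - 2T) ≤ 2ḡ ε once the ε terms are collected; `h2`
  -- then replaces ḡ ε.
  have h1 : 4 * g * (1 / (2 * g) * (Γ.epsilon / 2 + T)) = Γ.epsilon + 2 * T := by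
    field_simp
    ring
  have h2 : g * Γ.epsilon = Γ.theta / 2 + 2 * (g - 1) * T := by
    rw [he]
    field_simp
  rw [h1, div_mul_eq_mul_div, div_le_iff₀ (by positivity)]
  constructor <;> intro h <;> linarith

theorem le_epsilon (Γ : PMGraph V E) :
    ((Γ.pmGenus : ℝ) - 1) / ((Γ.pmGenus : ℝ) + 1)
        * (Γ.totalLength - 4 * (Γ.pmGenus : ℝ) * Γ.aInv) ≤ Γ.epsilon := by
  obtain ⟨G, hG⟩ := Γ.exists_isGreen Γ.connected
  obtain ⟨p⟩ := Γ.connected.1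
  rw [le_epsilon_iff, hG.tau_eq Γ.connected (.vertex p)]
  linarith [totalLength_mul_le hG (.vertex p)]

end PMGraph

end

theorem mainTheorem12 {V E : Type*} [Fintype V] [Fintype E] (Γ : PMGraph V E) :
    (Γ.Bridgeless →
      ((Γ.pmGenus : ℝ) - 1) / ((Γ.pmGenus : ℝ) + 1)
          * (Γ.totalLength - 4 * (Γ.pmGenus : ℝ) * Γ.aInv) ≤ Γ.epsilon ∧
      (2 ≤ Γ.pmGenus →
        (((Γ.pmGenus : ℝ) - 1) / ((Γ.pmGenus : ℝ) + 1)
            * (Γ.totalLength - 4 * (Γ.pmGenus : ℝ) * Γ.aInv) ≤ Γ.epsilon ↔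
          Γ.totalLength ≤ 12 * Γ.tau + Γ.theta / ((Γ.pmGenus : ℝ) - 1)))) ∧
    (Γ.Irreducible →
      ((Γ.pmGenus : ℝ) - 1) / ((Γ.pmGenus : ℝ) + 1)
          * (Γ.totalLength - 4 * (Γ.pmGenus : ℝ) * Γ.aInv) ≤ Γ.epsilon) := by
  refine ⟨fun _ => ⟨Γ.le_epsilon, fun hg => ?_⟩, fun _ => Γ.le_epsilon⟩
  have hg' : (0 : ℝ) < (Γ.pmGenus : ℝ) - 1 := by
    have : (2 : ℝ) ≤ (Γ.pmGenus : ℝ) := by exact_mod_cast hg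
    linarith
  rw [Γ.le_epsilon_iff, ← sub_le_iff_le_add' (b := 12 * Γ.tau), le_div_iff₀ hg']
  constructor <;> intro h <;> linarith
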